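/- Let $\nabla(K)\in\mathbb Z[z]$ denote the Conway polynomial of an oriented link $K\subset S^3$, i.e. the isotopy invariant defined by $\nabla(\text{unknot})=1$ and the skein relation $$\nabla(K_+)-\nabla(K_-)=-z\,\nabla(K_0),$$ where $K_+,K_-,K_0$ have diagrams that agree except near one point, where $K_+$ has a positive crossing, $K_-$ a negative crossing, and $K_0$ the oriented resolution. For an integer $n\ge 0$ let $T_n$ be the following tangle diagram on three vertical strands, read from bottom to top, the strands present at each height being numbered from left to right: (1) a local minimum creates two new strands between the second and the third strand; (2) the fourth and fifth strands cross, the strand running from lower left to upper right being on top; (3) the third and fourth strands, which are antiparallel in the knot $L_n$ below, twist around each other through $n$ left-handed full twists ($2n$ crossings); (4) the second and third strands cross, the strand running from lower right to upper left being on top; (5) the first and second strands cross, the strand running from lower left to upper right being on top; (6) a local maximum joins the second and third strands. The closure of $T_n$ (top ends joined to bottom ends as for a braid) is an unknot $C_1$. Let $C_2$ be an unknot encircling its three parallel strands, and let $L_n=K_2(n)$ be the knot obtained from $C_1$ by blowing down $C_2$ with framing $+1$; that is, $L_n$ is the closure of $T_n$ followed by one left-handed full twist on the three strands. (So $L_0=5_2$,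 $L_1=9_{45}$, $L_2=11n_{63}$, up to mirror images; in general $L_n$ is, up to mirror image, the Montesinos knot with Conway notation $(2n)\,1\,1,\ 2\,1,\ 2-$.) Then for every $n\ge 0$ $$\nabla(L_n)=1+2z^2-n z^4 .$$ In particular, the coefficient of $z^4$ in $\nabla(L_n)$ is $-n$. -/

import Mathlib

open Polynomial

namespace KnotSkein

/-! ### Oriented link diagrams

A diagram is drawn in generic position with respect to height and recorded, from bottom to top, as
the list of its elementary events: local minima, local maxima and crossings.  An event is placed by
the number of strands to the left of it.  We use long diagrams: one strand comes from below and
leaves at the top, and is closed up through the point at infinity of the sphere.  Every diagram of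
a nonempty oriented link on the sphere becomes such a diagram by cutting one of its edges, so a
long diagram is a diagram of an oriented link in the three-sphere with a base point. -/

/-- The elementary events.
* `cup b`: a local minimum; its left leg is oriented upwards iff `b = true` (and then its right leg
  is oriented downwards, and conversely).
* `cap`: a local maximum.
* `cross s`: two adjacent strands cross; for `s = true` the strand from the lower left to the upper
  right passes over, for `s = false` the strand from the lower right to the upper left does. -/
inductive Kind
  | cup (b : Bool)
  | cap
  | cross (s : Bool)
  deriving DecidableEq

/-- The number of strands that enter an event from below. -/
def Kind.dom : Kind → ℕ
  | .cup _ => 0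
  | .cap => 2
  | .cross _ => 2

/-- The number of strands that leave an event at its top. -/
def Kind.cod : Kind → ℕ
  | .cup _ => 2
  | .cap => 0
  | .cross _ => 2

/-- An event together with the number of strands to its left. -/
structure Slice where
  kind : Kind
  pos : ℕ
  deriving DecidableEq

/-- A local minimum with `i` strands to its left. -/
abbrev cup (i : ℕ) (b : Bool) : Slice := ⟨.cup b, i⟩

/-- A local maximum with `i` strands to its left. -/
abbrev cap (i : ℕ) : Slice := ⟨.cap, i⟩

/-- A crossing with `i` strands to its left. -/
abbrev cross (i : ℕ) (s : Bool) : Slice := ⟨.cross s, i⟩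

/-- Words in events, read from bottom to top. -/
abbrev Word := List Slice

/-- The effect of an event on a horizontal level.  A level is the list of the orientations of its
strands from left to right (`true` is upwards).  The result is `none` if the event does not fit:
too few strands, or a local maximum joining two strands with the same vertical direction. -/
def step (w : List Bool) (e : Slice) : Option (List Bool) :=
  match e.kind with
  | .cup b =>
      if e.pos ≤ w.length then some (w.take e.pos ++ b :: (!b) :: w.drop e.pos) else none
  | .cap =>
      match w.drop e.pos with
      | a :: b :: r => if a = b then none else some (w.take e.pos ++ r)
      | _ => none
  | .cross _ =>
      match w.drop e.pos with
      | a :: b :: r => some (w.take e.pos ++ b :: a :: r)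
      | _ => none

/-- The level reached from the level `w` after all events of a word. -/
def run (w : List Bool) : Word → Option (List Bool)
  | [] => some w
  | e :: D =>
      match step w e with
      | some w' => run w' D
      | none => none

/-- A word is an oriented (long) link diagram if it leads from one upward strand to one upward
strand. -/
def IsDiagram (D : Word) : Prop := run [true] D = some [true]

/-! ### Isotopy -/

/-- The local moves between words that generate isotopy of oriented links: planar isotopy
(`exchange`, `zigzagLeft`, `zigzagRight`), the three Reidemeister moves, and the isotopies that
push a strand across a local minimum or maximum. -/
inductive Move : Word → Word → Prop
  /-- Two events, the second at a distance of `k` strands to the right of the first, exchange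
  their heights. -/
  | exchange (p q : Kind) (i k : ℕ) :
      Move [⟨p, i⟩, ⟨q, i + p.cod + k⟩] [⟨q, i + p.dom + k⟩, ⟨p, i⟩]
  | zigzagLeft (i : ℕ) (b : Bool) : Move [cup i b, cap (i + 1)] []
  | zigzagRight (i : ℕ) (b : Bool) : Move [cup (i + 1) b, cap i] []
  | reidemeister1Cup (i : ℕ) (b s : Bool) : Move [cup i b, cross i s] [cup i (!b)]
  | reidemeister1Cap (i : ℕ) (s : Bool) : Move [cross i s, cap i] [cap i]
  | reidemeister2 (i : ℕ) (s : Bool) : Move [cross i s, cross i (!s)] []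
  /-- Three strands; the condition says that one of them is on top, one in the middle and one at
  the bottom. -/
  | reidemeister3 (i : ℕ) (a b c : Bool) (h : b = a ∨ b = c) :
      Move [cross i a, cross (i + 1) b, cross i c] [cross (i + 1) c, cross i b, cross (i + 1) a]
  | slideCup (i : ℕ) (b s : Bool) :
      Move [cup i b, cross (i + 1) s] [cup (i + 1) b, cross i (!s)]
  | slideCap (i : ℕ) (s : Bool) :
      Move [cross i s, cap (i + 1)] [cross (i + 1) (!s), cap i]

/-- A local move performed inside a diagram. -/
inductive MoveIn : Word → Word → Prop
  | mk (x y u v : Word) (h : Move u v) (hu : IsDiagram (x ++ u ++ y))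
      (hv : IsDiagram (x ++ v ++ y)) : MoveIn (x ++ u ++ y) (x ++ v ++ y)

/-- Isotopy of diagrams: the equivalence relation generated by the local moves. -/
def Isotopic (D E : Word) : Prop := Relation.EqvGen MoveIn D E

/-! ### The Conway polynomial -/

/-- The oriented resolution of a crossing with `i` strands to its left whose lower ends have the
orientations `a` (left) and `b` (right).  If both strands point upwards or both downwards, they
become two vertical strands, otherwise a local maximum below a local minimum. -/
def resolution (i : ℕ) (a b : Bool) : Word :=
  if a = b then [] else [cap i, cup i b]

/-- `SkeinTriple P M O`: the diagrams `P`, `M`, `O` agree except near one place, where `P` has a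
positive crossing, `M` a negative crossing, and `O` the oriented resolution.  The crossing
`cross i s` is positive iff `s = true` and the two strands have the same vertical direction, or
`s = false` and they have opposite vertical directions. -/
inductive SkeinTriple : Word → Word → Word → Prop
  | mk (x y : Word) (w : List Bool) (i : ℕ) (a b : Bool)
      (hx : run [true] x = some w) (ha : w[i]? = some a) (hb : w[i + 1]? = some b)
      (hD : IsDiagram (x ++ [cross i (a == b)] ++ y)) :
      SkeinTriple (x ++ [cross i (a == b)] ++ y) (x ++ [cross i (!(a == b))] ++ y)
        (x ++ resolution i a b ++ y)

/-- `HasConway D p`: skein theory gives the diagram `D` the polynomial `p` in the variable `z = X`.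
This is the least relation that is invariant under isotopy, contains `∇(unknot) = 1`, and contains,
for every skein triple and any two of its members, what the relation `∇(P) - ∇(M) = -z ∇(O)` gives
for the third. -/
inductive HasConway : Word → ℤ[X] → Prop
  /-- The empty word is the diagram of the unknot without any crossing. -/
  | unknot : HasConway [] 1
  | isotopy {D E : Word} {p : ℤ[X]} (h : Isotopic D E) (hD : HasConway D p) : HasConway E p
  | positive {P M O : Word} {p m o : ℤ[X]} (h : SkeinTriple P M O)
      (hM : HasConway M m) (hO : HasConway O o) (e : p - m = -X * o) : HasConway P p
  | negative {P M O : Word} {p m o : ℤ[X]} (h : SkeinTriple P M O)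
      (hP : HasConway P p) (hO : HasConway O o) (e : p - m = -X * o) : HasConway M m
  | resolved {P M O : Word} {p m o : ℤ[X]} (h : SkeinTriple P M O)
      (hP : HasConway P p) (hM : HasConway M m) (e : p - m = -X * o) : HasConway O o

open Classical in
/-- The Conway polynomial of a diagram: the one and only polynomial that skein theory gives it.
(The value `0` is used for words for which there is none or more than one.) -/
noncomputable def conway (D : Word) : ℤ[X] :=
  if h : ∃! p, HasConway D p then h.choose else 0

/-! ### The knots `L n = K₂(n)` -/

/-- The module: two adjacent strands with `i` strands to their left twist around each other with
`n` left-handed full twists (`2 * n` crossings).  In `L n` the two strands are antiparallel, so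
these crossings are positive. -/
def leftTwists (i n : ℕ) : Word := List.replicate (2 * n) (cross i false)

/-- One left-handed full twist of the three leftmost strands.  This is the result of blowing down
an unknot of framing `+1` that encircles these three strands. -/
def leftFullTwistThree : Word :=
  [cross 0 false, cross 1 false, cross 0 false, cross 1 false, cross 0 false, cross 1 false]

/-- The tangle on three strands which carries the module.  Its closure in the plane is the unknot
`C₁`, and the unknot `C₂` of framing `+1` encircles the three strands of the closure. -/
def moduleTangle (n : ℕ) : Word :=
  [cup 2 true, cross 3 true] ++ leftTwists 2 n ++ [cross 1 false, cross 0 true, cap 1]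

/-- The knot `K₂(n)`: the closure of the tangle with the module followed by the left-handed full
twist of the three strands that replaces `C₂`.  (The two cups and the two caps close the second and
the third strand on the right; the first strand is closed through infinity.) -/
def L (n : ℕ) : Word :=
  [cup 1 false, cup 2 false] ++ moduleTangle n ++ leftFullTwistThree ++ [cap 2, cap 1]

end KnotSkein

/-! The value of `conway` is meaningful only if skein theory assigns exactly one polynomial to
`L n`, so the proof has two halves.

*Uniqueness.*  The Conway polynomial is realised by a state sum, the one of the `R`-matrix of the
quantum supergroup `gl(1|1)` (the free-fermion six-vertex model).  The edges of a diagram carry one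
of two labels, and each event of a word acts as a linear operator on functions of the labels of a
level.  Every local move preserves the operator (`Move.sound`): for the exchange of distant events
this holds because operators on different strands commute, and for the other moves it is a finite
family of polynomial identities between the weights.  The operators satisfy the skein relation with
`z = q⁻¹ - q` (`SkeinTriple.value_eq`).  Hence the state sum of a diagram is the value at `q⁻¹ - q`
of each polynomial that skein theory gives it (`HasConway.value_eq`); letting `q` vary over the
rationals gives uniqueness.

*Existence.*  Changing one crossing of the twists turns `L (n + 1)` into `L n`, and resolving it
turns the other crossings of the twists into kinks, so that the resolution is the same link for all
`n`.  Its polynomial is `z ^ 3` (`HasConway.closure_resolved_twists`), hence each step subtracts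
`z ^ 4` from the polynomial `1 + 2 * z ^ 2` of `L 0` (`hasConway_L_zero`).  Both polynomials come
from short skein trees that end in unknots, split links, the Hopf link and the torus link `T(2, 4)`
with antiparallel strands. -/

namespace KnotSkein

/-! ### Polynomials as coefficient lists -/

/-- An integer polynomial in `q`, as the list of its coefficients from degree `0` on; trailing zeros
are allowed.  Unlike `Polynomial`, this can be evaluated by the kernel. -/
abbrev Coeffs := List ℤ

def Coeffs.add : Coeffs → Coeffs → Coeffs
  | [], m => m
  | l, [] => l
  | a :: l, b :: m => (a + b) :: Coeffs.add l m

def Coeffs.mul : Coeffs → Coeffs → Coeffs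
  | [], _ => []
  | a :: l, m => Coeffs.add (m.map (a * ·)) (0 :: Coeffs.mul l m)

/-- Equality as polynomials, that is, up to trailing zeros. -/
def Coeffs.beq (l m : Coeffs) : Bool := (Coeffs.add l (m.map (-·))).all (· == 0)

def Coeffs.sum (f : Bool → Coeffs) : Coeffs := Coeffs.add (f true) (f false)

/-- The polynomial `l` if `p` holds, otherwise `0`. -/
def Coeffs.ite (p : Bool) (l : Coeffs) : Coeffs := bif p then l else []

/-! ### The weights of the state sum -/

/-- The sign `(-1) ^ x` as a constant polynomial. -/
def sgn (x : Bool) : Coeffs := if x then [-1] else [1]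

/-- `q` times the entry of the `R`-matrix (for the argument `true`) or of its inverse (for `false`)
with lower labels `x`, `y` and upper labels `x'`, `y'`.  The matrix
`R = diag(q, [[q - q⁻¹, 1], [1, 0]], -q⁻¹)` is the one of the quantum supergroup `gl(1|1)` with the
signs absorbed; it satisfies `R - R⁻¹ = q - q⁻¹`, which is the skein relation for `z = q⁻¹ - q`. -/
def rCoeffs : Bool → Bool → Bool → Bool → Bool → Coeffs
  | true, false, false, false, false => [0, 0, 1]
  | true, true, true, true, true => [-1]
  | true, false, true, false, true => [-1, 0, 1]
  | false, false, false, false, false => [1]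
  | false, true, true, true, true => [0, 0, -1]
  | false, true, false, true, false => [1, 0, -1]
  | _, true, false, false, true => [0, 1]
  | _, false, true, true, false => [0, 1]
  | _, _, _, _, _ => []

/-- `q` times the weight of the crossing `cross s` with lower orientations `a`, `b`, lower labels
`x`, `y` and upper labels `x'`, `y'`.  If a strand points downwards, the weight is the one that the
moves `slideCup` force upon it. -/
def crossCoeffs (s : Bool) : Bool → Bool → Bool → Bool → Bool → Bool → Coeffs
  | true, true, x, y, x', y' => rCoeffs s x y x' y'
  | true, false, x, y, x', y' => rCoeffs (!s) x' x y' y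
  | false, true, x, y, x', y' => .mul (.mul (sgn x) (sgn y')) (rCoeffs (!s) y y' x x')
  | false, false, x, y, x', y' => rCoeffs s y' x' y x

/-- The weight of a local minimum with left orientation `b` whose two legs carry the label `x`. -/
def cupCoeffs (b x : Bool) : Coeffs := if b then .mul [0, 1] (sgn x) else [1]

/-- `q` times the weight of a local maximum with left orientation `a` whose two legs carry the
label `x`. -/
def capCoeffs (a x : Bool) : Coeffs := if a then [0, 1] else sgn x

open Coeffs in
/-- The Yang-Baxter equation for all orientations and all admissible choices of signs.  The inner
sums are placed so that the kernel can skip them where the outer weight is `0`. -/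
theorem crossCoeffs_reidemeister3 : ∀ a b c : Bool, b = a ∨ b = c →
    ∀ o₁ o₂ o₃ x₁ x₂ x₃ y₁ y₂ y₃ : Bool, Coeffs.beq
    (.sum fun t₁ => .sum fun t₂ => mul (crossCoeffs a o₁ o₂ x₁ x₂ t₁ t₂)
      (.sum fun t₃ => mul (crossCoeffs b o₁ o₃ t₂ x₃ t₃ y₃) (crossCoeffs c o₂ o₃ t₁ t₃ y₁ y₂)))
    (.sum fun t₂ => .sum fun t₃ => mul (crossCoeffs c o₂ o₃ x₂ x₃ t₂ t₃)
      (.sum fun t₁ => mul (crossCoeffs b o₁ o₃ x₁ t₂ y₁ t₁)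
        (crossCoeffs a o₁ o₂ t₁ t₃ y₂ y₃))) = true := by
  decide +kernel

open Coeffs in
theorem crossCoeffs_reidemeister2 : ∀ s a b x₁ x₂ y₁ y₂ : Bool, Coeffs.beq
    (.sum fun t₁ => .sum fun t₂ =>
      mul (crossCoeffs s a b x₁ x₂ t₁ t₂) (crossCoeffs (!s) b a t₁ t₂ y₁ y₂))
    (.ite (x₁ == y₁ && x₂ == y₂) [0, 0, 1]) = true := by
  decide +kernel

open Coeffs in
theorem crossCoeffs_cup : ∀ s b y₁ y₂ : Bool, Coeffs.beq
    (.sum fun t => mul (crossCoeffs s b (!b) t t y₁ y₂) (cupCoeffs b t))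
    (.ite (y₁ == y₂) (mul [0, 1] (cupCoeffs (!b) y₁))) = true := by
  decide +kernel

open Coeffs in
theorem crossCoeffs_cap : ∀ s a x₁ x₂ : Bool, Coeffs.beq
    (.sum fun t => mul (capCoeffs (!a) t) (crossCoeffs s a (!a) x₁ x₂ t t))
    (.ite (x₁ == x₂) (mul [0, 1] (capCoeffs a x₁))) = true := by
  decide +kernel

open Coeffs in
theorem crossCoeffs_slideCup : ∀ s b c p t x y : Bool, Coeffs.beq
    (mul (crossCoeffs s (!b) c p t x y) (cupCoeffs b p))
    (mul (crossCoeffs (!s) c b t y p x) (cupCoeffs b y)) = true := by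
  decide +kernel

open Coeffs in
theorem crossCoeffs_slideCap : ∀ s a b x y z t : Bool, Coeffs.beq
    (mul (capCoeffs a z) (crossCoeffs s a b x y t z))
    (mul (capCoeffs a x) (crossCoeffs (!s) b (!a) y z x t)) = true := by
  decide +kernel

open Coeffs in
theorem crossCoeffs_skein_parallel : ∀ a x₁ x₂ y₁ y₂ : Bool, Coeffs.beq
    (crossCoeffs true a a x₁ x₂ y₁ y₂)
    (add (crossCoeffs false a a x₁ x₂ y₁ y₂)
      (.ite (x₁ == y₁ && x₂ == y₂) [-1, 0, 1])) = true := by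
  decide +kernel

open Coeffs in
theorem crossCoeffs_skein_antiparallel : ∀ a x₁ x₂ y₁ y₂ : Bool, Coeffs.beq
    (mul [0, 1] (crossCoeffs false a (!a) x₁ x₂ y₁ y₂))
    (add (mul [0, 1] (crossCoeffs true a (!a) x₁ x₂ y₁ y₂))
      (.ite (x₁ == x₂ && y₁ == y₂) (mul [-1, 0, 1] (mul (capCoeffs a x₁) (cupCoeffs (!a) y₁)))))
      = true := by
  decide +kernel

variable {K : Type*} [Field K]

namespace Coeffs

/-- The value of the polynomial at `q`. -/
def eval (q : K) : Coeffs → K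
  | [] => 0
  | a :: l => a + q * eval q l

@[simp] theorem eval_add (q : K) : ∀ l m : Coeffs, (l.add m).eval q = l.eval q + m.eval q
  | [], m => by simp [add, eval]
  | a :: l, [] => by simp [add, eval]
  | a :: l, b :: m => by
    simp only [add, eval, eval_add q l m, Int.cast_add]
    ring

theorem eval_map_mul (q : K) (a : ℤ) (l : Coeffs) : eval q (l.map (a * ·)) = a * l.eval q := by
  induction l with
  | nil => simp [eval]
  | cons b l ih =>
    simp only [List.map_cons, eval, ih, Int.cast_mul]
    ring

@[simp] theorem eval_mul (q : K) (l m : Coeffs) : (l.mul m).eval q = l.eval q * m.eval q := by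
  induction l with
  | nil => simp [mul, eval]
  | cons a l ih =>
    simp only [mul, eval_add, eval_map_mul, eval, ih, Int.cast_zero]
    ring

theorem eval_eq_zero (q : K) {l : Coeffs} (h : l.all (· == 0) = true) : l.eval q = 0 := by
  induction l with
  | nil => rfl
  | cons a l ih =>
    simp only [List.all_cons, Bool.and_eq_true, beq_iff_eq] at h
    simp [eval, h.1, ih h.2]

theorem eval_eq (q : K) {l m : Coeffs} (h : l.beq m = true) : l.eval q = m.eval q := by
  have h1 := eval_eq_zero q h
  have h2 : m.map (-·) = m.map ((-1 : ℤ) * ·) := by simp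
  rw [h2, eval_add, eval_map_mul] at h1
  push_cast at h1
  linear_combination h1

@[simp] theorem eval_sum (q : K) (f : Bool → Coeffs) :
    (Coeffs.sum f).eval q = ∑ x, (f x).eval q := by
  simp [Coeffs.sum]

@[simp] theorem eval_ite (q : K) (p : Bool) (l : Coeffs) :
    (Coeffs.ite p l).eval q = if p then l.eval q else 0 := by
  cases p <;> rfl

end Coeffs

variable {q : K}

/-- The weight of a crossing in the state sum. -/
def crossWeight (q : K) (s a b x y x' y' : Bool) : K := q⁻¹ * (crossCoeffs s a b x y x' y').eval q

/-- The weight of a local minimum in the state sum. -/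
def cupWeight (q : K) (b x : Bool) : K := (cupCoeffs b x).eval q

/-- The weight of a local maximum in the state sum. -/
def capWeight (q : K) (a x : Bool) : K := q⁻¹ * (capCoeffs a x).eval q

theorem crossWeight_reidemeister3 {a b c : Bool} (h : b = a ∨ b = c)
    (o₁ o₂ o₃ x₁ x₂ x₃ y₁ y₂ y₃ : Bool) :
    (∑ t₁, ∑ t₂, ∑ t₃, crossWeight q a o₁ o₂ x₁ x₂ t₁ t₂ *
      (crossWeight q b o₁ o₃ t₂ x₃ t₃ y₃ * crossWeight q c o₂ o₃ t₁ t₃ y₁ y₂)) =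
    ∑ t₂, ∑ t₃, ∑ t₁, crossWeight q c o₂ o₃ x₂ x₃ t₂ t₃ *
      (crossWeight q b o₁ o₃ x₁ t₂ y₁ t₁ * crossWeight q a o₁ o₂ t₁ t₃ y₂ y₃) := by
  have := Coeffs.eval_eq q (crossCoeffs_reidemeister3 a b c h o₁ o₂ o₃ x₁ x₂ x₃ y₁ y₂ y₃)
  simp only [Coeffs.eval_sum, Coeffs.eval_mul, Fintype.sum_bool] at this
  simp only [crossWeight, Fintype.sum_bool]
  linear_combination q⁻¹ ^ 3 * this

theorem crossWeight_reidemeister2 (hq : q ≠ 0) (s a b x₁ x₂ y₁ y₂ : Bool) :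
    (∑ t₁, ∑ t₂, crossWeight q s a b x₁ x₂ t₁ t₂ * crossWeight q (!s) b a t₁ t₂ y₁ y₂) =
      if x₁ = y₁ ∧ x₂ = y₂ then 1 else 0 := by
  have := Coeffs.eval_eq q (crossCoeffs_reidemeister2 s a b x₁ x₂ y₁ y₂)
  simp only [Coeffs.eval_sum, Coeffs.eval_mul, Fintype.sum_bool, Coeffs.eval_ite,
    Bool.and_eq_true, beq_iff_eq] at this
  simp only [crossWeight, Fintype.sum_bool]
  have h2 : (if x₁ = y₁ ∧ x₂ = y₂ then (1 : K) else 0) =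
      q⁻¹ ^ 2 * if x₁ = y₁ ∧ x₂ = y₂ then Coeffs.eval q [0, 0, 1] else 0 := by
    split_ifs <;> simp [Coeffs.eval]
    field_simp
  rw [h2]
  linear_combination q⁻¹ ^ 2 * this

theorem crossWeight_cup (hq : q ≠ 0) (s b y₁ y₂ : Bool) :
    (∑ t, crossWeight q s b (!b) t t y₁ y₂ * cupWeight q b t) =
      if y₁ = y₂ then cupWeight q (!b) y₁ else 0 := by
  have := Coeffs.eval_eq q (crossCoeffs_cup s b y₁ y₂)
  simp only [Coeffs.eval_sum, Coeffs.eval_mul, Fintype.sum_bool, Coeffs.eval_ite,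
    beq_iff_eq] at this
  simp only [crossWeight, Fintype.sum_bool, cupWeight]
  have h2 : (if y₁ = y₂ then (cupCoeffs (!b) y₁).eval q else 0) = q⁻¹ *
      if y₁ = y₂ then Coeffs.eval q [0, 1] * (cupCoeffs (!b) y₁).eval q else 0 := by
    split_ifs <;> simp [Coeffs.eval]
    field_simp
  rw [h2]
  linear_combination q⁻¹ * this

theorem crossWeight_cap (hq : q ≠ 0) (s a x₁ x₂ : Bool) :
    (∑ t, capWeight q (!a) t * crossWeight q s a (!a) x₁ x₂ t t) =
      if x₁ = x₂ then capWeight q a x₁ else 0 := by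
  have := Coeffs.eval_eq q (crossCoeffs_cap s a x₁ x₂)
  simp only [Coeffs.eval_sum, Coeffs.eval_mul, Fintype.sum_bool, Coeffs.eval_ite,
    beq_iff_eq] at this
  simp only [crossWeight, Fintype.sum_bool, capWeight]
  have h2 : (if x₁ = x₂ then q⁻¹ * (capCoeffs a x₁).eval q else 0) = q⁻¹ ^ 2 *
      if x₁ = x₂ then Coeffs.eval q [0, 1] * (capCoeffs a x₁).eval q else 0 := by
    split_ifs <;> simp [Coeffs.eval]
    field_simp
  rw [h2]
  linear_combination q⁻¹ ^ 2 * this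

theorem crossWeight_slideCup (s b c p t x y : Bool) :
    crossWeight q s (!b) c p t x y * cupWeight q b p =
      crossWeight q (!s) c b t y p x * cupWeight q b y := by
  have := Coeffs.eval_eq q (crossCoeffs_slideCup s b c p t x y)
  simp only [Coeffs.eval_mul] at this
  simp only [crossWeight, cupWeight]
  linear_combination q⁻¹ * this

theorem crossWeight_slideCap (s a b x y z t : Bool) :
    capWeight q a z * crossWeight q s a b x y t z =
      capWeight q a x * crossWeight q (!s) b (!a) y z x t := by
  have := Coeffs.eval_eq q (crossCoeffs_slideCap s a b x y z t)
  simp only [Coeffs.eval_mul] at this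
  simp only [crossWeight, capWeight]
  linear_combination q⁻¹ ^ 2 * this

theorem crossWeight_skein_parallel (hq : q ≠ 0) (a x₁ x₂ y₁ y₂ : Bool) :
    crossWeight q true a a x₁ x₂ y₁ y₂ = crossWeight q false a a x₁ x₂ y₁ y₂ +
      (q - q⁻¹) * if x₁ = y₁ ∧ x₂ = y₂ then 1 else 0 := by
  have := Coeffs.eval_eq q (crossCoeffs_skein_parallel a x₁ x₂ y₁ y₂)
  simp only [Coeffs.eval_add, Coeffs.eval_ite, Bool.and_eq_true, beq_iff_eq] at this
  simp only [crossWeight, this]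
  split_ifs <;> simp [Coeffs.eval]
  field_simp
  ring

theorem crossWeight_skein_antiparallel (hq : q ≠ 0) (a x₁ x₂ y₁ y₂ : Bool) :
    crossWeight q false a (!a) x₁ x₂ y₁ y₂ = crossWeight q true a (!a) x₁ x₂ y₁ y₂ +
      (q - q⁻¹) * if x₁ = x₂ ∧ y₁ = y₂ then capWeight q a x₁ * cupWeight q (!a) y₁ else 0 := by
  have := Coeffs.eval_eq q (crossCoeffs_skein_antiparallel a x₁ x₂ y₁ y₂)
  have h1 : Coeffs.eval q [0, 1] = q := by simp [Coeffs.eval]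
  have h2 : Coeffs.eval q [-1, 0, 1] = q ^ 2 - 1 := by simp [Coeffs.eval]; ring
  simp only [Coeffs.eval_add, Coeffs.eval_ite, Coeffs.eval_mul, Bool.and_eq_true, beq_iff_eq,
    h1, h2] at this
  simp only [crossWeight, capWeight, cupWeight]
  split_ifs at this ⊢ with h
  · field_simp
    linear_combination this
  · simp only [add_zero, mul_eq_mul_left_iff, hq, or_false] at this
    rw [this, mul_zero, add_zero]

theorem capWeight_mul_cupWeight (hq : q ≠ 0) (b x : Bool) :
    capWeight q (!b) x * cupWeight q b x = 1 := by
  cases b <;> cases x <;> simp [capWeight, cupWeight, capCoeffs, cupCoeffs, sgn, Coeffs.eval,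
    Coeffs.mul, Coeffs.add, hq]

/-! ### The state sum -/

/-- The weight of an event, given the orientations and labels of the strands that enter it from
below and the labels of the strands that leave it at the top.  The lists are meant to have the
lengths `dom`, `dom` and `cod`. -/
def amp (q : K) : Kind → List Bool → List Bool → List Bool → K
  | .cup b, _, [], [x, y] => if x = y then cupWeight q b x else 0
  | .cap, [a, _], [x, y], [] => if x = y then capWeight q a x else 0
  | .cross s, [a, b], [x, y], [x', y'] => crossWeight q s a b x y x' y'
  | _, _, _, _ => 0

/-- The sum over all labellings of the strands that enter an event from below. -/
def Kind.sum : Kind → (List Bool → K) → K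
  | .cup _, f => f []
  | _, f => ∑ x, ∑ y, f [x, y]

/-- The linear operator of an event on functions of the labels of a level; `w` is the list of the
orientations below the event. -/
def act (q : K) (w : List Bool) (e : Slice) (ψ : List Bool → K) (y : List Bool) : K :=
  e.kind.sum fun x =>
    amp q e.kind ((w.drop e.pos).take e.kind.dom) x ((y.drop e.pos).take e.kind.cod) *
      ψ (y.take e.pos ++ x ++ y.drop (e.pos + e.kind.cod))

/-- The linear operator of a word that starts at the level `w`.  At an event that does not fit the
next level is a junk value; `run` is assumed to succeed wherever this matters. -/
def evolve (q : K) (w : List Bool) : Word → (List Bool → K) → List Bool → K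
  | [], ψ => ψ
  | e :: D, ψ => evolve q ((step w e).getD []) D (act q w e ψ)

theorem Kind.sum_congr (k : Kind) {f g : List Bool → K}
    (h : ∀ x, x.length = k.dom → f x = g x) : k.sum f = k.sum g := by
  cases k with
  | cup b => exact h [] rfl
  | cap => exact Finset.sum_congr rfl fun x _ => Finset.sum_congr rfl fun y _ => h [x, y] rfl
  | cross s => exact Finset.sum_congr rfl fun x _ => Finset.sum_congr rfl fun y _ => h [x, y] rfl

theorem Kind.sum_add (k : Kind) (f g : List Bool → K) :
    (k.sum fun x => f x + g x) = k.sum f + k.sum g := by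
  cases k <;> simp [Kind.sum, Finset.sum_add_distrib]

theorem Kind.mul_sum (k : Kind) (c : K) (f : List Bool → K) :
    (k.sum fun x => c * f x) = c * k.sum f := by
  cases k <;> simp [Kind.sum] <;> ring

theorem Kind.sum_comm (k l : Kind) (f : List Bool → List Bool → K) :
    (k.sum fun x => l.sum fun y => f x y) = l.sum fun y => k.sum fun x => f x y := by
  cases k <;> cases l <;> simp [Kind.sum] <;> ring

theorem step_length {w r : List Bool} {e : Slice} (h : step w e = some r) :
    e.pos + e.kind.dom ≤ w.length ∧ r.length + e.kind.dom = w.length + e.kind.cod := by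
  obtain ⟨k, i⟩ := e
  cases k with
  | cup b =>
    simp only [step] at h
    split_ifs at h with hi
    simp only [Option.some.injEq] at h
    subst h
    simp [Kind.dom, Kind.cod] at *
    omega
  | cap =>
    simp only [step] at h
    split at h
    · rename_i a b t ht
      have hl := congrArg List.length ht
      split_ifs at h
      simp only [Option.some.injEq] at h
      subst h
      simp [Kind.dom, Kind.cod] at *
      omega
    · simp at h
  | cross s =>
    simp only [step] at h
    split at h
    · rename_i a b t ht
      have hl := congrArg List.length ht
      simp only [Option.some.injEq] at h
      subst h
      simp [Kind.dom, Kind.cod] at *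
      omega
    · simp at h

/-- The same event with `i` more strands to its left. -/
def Slice.shift (i : ℕ) (e : Slice) : Slice := ⟨e.kind, i + e.pos⟩

theorem step_append (A C w : List Bool) (e : Slice) (h : e.pos + e.kind.dom ≤ w.length) :
    step (A ++ w ++ C) (e.shift A.length) = (step w e).map fun r => A ++ r ++ C := by
  obtain ⟨k, i⟩ := e
  have hd : (A ++ w ++ C).drop (A.length + i) = w.drop i ++ C := by
    rw [List.append_assoc, ← List.drop_drop, List.drop_left,
      List.drop_append_of_le_length (by simp at h; omega)]
  have ht : (A ++ w ++ C).take (A.length + i) = A ++ w.take i := by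
    rw [List.append_assoc, List.take_add, List.take_left, List.drop_left,
      List.take_append_of_le_length (by simp at h; omega)]
  cases k with
  | cup b =>
    simp only [Kind.dom, add_zero] at h
    have h2 : A.length + i ≤ (A ++ w ++ C).length := by simp; omega
    simp only [step, Slice.shift, hd, ht, if_pos h, if_pos h2]
    simp
  | cap =>
    simp only [Kind.dom] at h
    obtain ⟨a, b, t, h3⟩ : ∃ a b t, w.drop i = a :: b :: t := by
      have hl : (w.drop i).length = w.length - i := by simp
      match hw : w.drop i with
      | [] => rw [hw] at hl; simp at hl; omega
      | [_] => rw [hw] at hl; simp at hl; omega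
      | a :: b :: t => exact ⟨a, b, t, rfl⟩
    rw [h3] at hd
    simp only [step, Slice.shift, hd, ht, h3, List.cons_append]
    split_ifs <;> simp
  | cross s =>
    simp only [Kind.dom] at h
    obtain ⟨a, b, t, h3⟩ : ∃ a b t, w.drop i = a :: b :: t := by
      have hl : (w.drop i).length = w.length - i := by simp
      match hw : w.drop i with
      | [] => rw [hw] at hl; simp at hl; omega
      | [_] => rw [hw] at hl; simp at hl; omega
      | a :: b :: t => exact ⟨a, b, t, rfl⟩
    rw [h3] at hd
    simp only [step, Slice.shift, hd, ht, h3, List.cons_append]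
    simp

theorem act_append (q : K) (A C w A' C' y : List Bool) (e : Slice) (ψ : List Bool → K)
    (hA : A'.length = A.length) (h : e.pos + e.kind.dom ≤ w.length)
    (h' : e.pos + e.kind.cod ≤ y.length) :
    act q (A ++ w ++ C) (e.shift A.length) ψ (A' ++ y ++ C') =
      act q w e (fun x => ψ (A' ++ x ++ C')) y := by
  obtain ⟨k, i⟩ := e
  simp only [Slice.shift] at *
  have hd : ((A ++ w ++ C).drop (A.length + i)).take k.dom = (w.drop i).take k.dom := by
    rw [List.append_assoc, ← List.drop_drop, List.drop_left,
      List.drop_append_of_le_length (by omega), List.take_append_of_le_length (by simp; omega)]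
  have hd' : ((A' ++ y ++ C').drop (A.length + i)).take k.cod = (y.drop i).take k.cod := by
    rw [← hA, List.append_assoc, ← List.drop_drop, List.drop_left,
      List.drop_append_of_le_length (by omega), List.take_append_of_le_length (by simp; omega)]
  have ht : (A' ++ y ++ C').take (A.length + i) = A' ++ y.take i := by
    rw [← hA, List.append_assoc, List.take_add, List.take_left, List.drop_left,
      List.take_append_of_le_length (by omega)]
  have hu : (A' ++ y ++ C').drop (A.length + i + k.cod) = y.drop (i + k.cod) ++ C' := by
    rw [← hA, List.append_assoc, add_assoc, ← List.drop_drop, List.drop_left,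
      List.drop_append_of_le_length (by omega)]
  simp only [act, hd, hd', ht, hu]
  simp only [List.append_assoc]

theorem run_append (w : List Bool) (D E : Word) : run w (D ++ E) = (run w D).bind (run · E) := by
  induction D generalizing w with
  | nil => rfl
  | cons e D ih =>
    simp only [List.cons_append, run]
    cases step w e with
    | none => rfl
    | some r => exact ih r

theorem evolve_append (q : K) {w r : List Bool} {D : Word} (h : run w D = some r) (E : Word)
    (ψ : List Bool → K) : evolve q w (D ++ E) ψ = evolve q r E (evolve q w D ψ) := by
  induction D generalizing w ψ with
  | nil => simp only [run, Option.some.injEq] at h; subst h; rfl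
  | cons e D ih =>
    simp only [List.cons_append, run] at h ⊢
    cases hs : step w e with
    | none => simp [hs] at h
    | some t =>
      simp only [hs] at h
      simpa only [evolve, hs, Option.getD_some] using ih h _

theorem evolve_congr (q : K) {w r : List Bool} {D : Word} (h : run w D = some r)
    {ψ φ : List Bool → K} (hψ : ∀ x, x.length = w.length → ψ x = φ x) (y : List Bool)
    (hy : y.length = r.length) : evolve q w D ψ y = evolve q w D φ y := by
  induction D generalizing w ψ φ with
  | nil => simp only [run, Option.some.injEq] at h; subst h; exact hψ y hy
  | cons e D ih =>
    simp only [run] at h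
    cases hs : step w e with
    | none => simp [hs] at h
    | some t =>
      simp only [hs] at h
      simp only [evolve, hs]
      refine ih h fun x hx => ?_
      obtain ⟨h1, h2⟩ := step_length hs
      refine Kind.sum_congr _ fun u hu => ?_
      rw [hψ]
      simp
      omega

theorem evolve_linear (q : K) (w : List Bool) (D : Word) (c : K) (ψ φ : List Bool → K) :
    evolve q w D (fun x => ψ x + c * φ x) =
      fun y => evolve q w D ψ y + c * evolve q w D φ y := by
  induction D generalizing w ψ φ with
  | nil => rfl
  | cons e D ih =>
    simp only [evolve]
    rw [← ih]
    congr 1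
    funext y
    simp only [act]
    rw [← Kind.mul_sum, ← Kind.sum_add]
    exact Kind.sum_congr _ fun x _ => by ring

/-- Starting from `n` strands, there are always enough strands for the next event. -/
def Fits : ℕ → Word → Prop
  | _, [] => True
  | n, e :: D => e.pos + e.kind.dom ≤ n ∧ Fits (n + e.kind.cod - e.kind.dom) D

theorem run_shift (A C : List Bool) {w : List Bool} {D : Word} (h : Fits w.length D) :
    run (A ++ w ++ C) (D.map (Slice.shift A.length)) = (run w D).map fun r => A ++ r ++ C := by
  induction D generalizing w with
  | nil => rfl
  | cons e D ih =>
    simp only [List.map_cons, run, step_append A C w e h.1]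
    cases hs : step w e with
    | none => rfl
    | some t =>
      have := step_length hs
      exact ih (by convert h.2 using 1; omega)

/-- A word acts on the middle part of a level only. -/
theorem evolve_shift (q : K) (A C A' C' : List Bool) (hA : A'.length = A.length)
    {w r y : List Bool} {D : Word} (h : run w D = some r) (hy : y.length = r.length)
    (ψ : List Bool → K) :
    evolve q (A ++ w ++ C) (D.map (Slice.shift A.length)) ψ (A' ++ y ++ C') =
      evolve q w D (fun x => ψ (A' ++ x ++ C')) y := by
  induction D generalizing w ψ with
  | nil => rfl
  | cons e D ih =>
    simp only [run] at h
    cases hs : step w e with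
    | none => simp [hs] at h
    | some t =>
      simp only [hs] at h
      obtain ⟨h1, h2⟩ := step_length hs
      simp only [List.map_cons, evolve, step_append A C w e h1, hs, Option.map_some,
        Option.getD_some]
      rw [ih h]
      exact evolve_congr q h (fun x hx => act_append q A C w A' C' x e ψ hA h1 (by omega)) y hy

theorem exists_split {l : List Bool} {i n : ℕ} (h : i + n ≤ l.length) :
    ∃ A u C, l = A ++ u ++ C ∧ A.length = i ∧ u.length = n :=
  ⟨l.take i, (l.drop i).take n, (l.drop i).drop n, by simp, by simp; omega, by simp; omega⟩

/-! ### Invariance under the local moves -/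

/-- The words `u` and `v`, as far as they can be applied to the level `w`, lead to the same level
and have the same operator. -/
def Sound (q : K) (w : List Bool) (u v : Word) : Prop :=
  ∀ r r', run w u = some r → run w v = some r' →
    r = r' ∧ ∀ ψ y, y.length = r.length → evolve q w u ψ y = evolve q w v ψ y

/-- Soundness may be checked on a level that has just the strands that take part in the move. -/
theorem Sound.shift {q : K} {u v : Word} {i n : ℕ} (hu : Fits n u) (hv : Fits n v)
    (h : ∀ w : List Bool, w.length = n → Sound q w u v) {w : List Bool} (hw : i + n ≤ w.length) :
    Sound q w (u.map (Slice.shift i)) (v.map (Slice.shift i)) := by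
  obtain ⟨A, w, C, rfl, rfl, rfl⟩ := exists_split hw
  intro r r' hr hr'
  rw [run_shift A C hu] at hr
  rw [run_shift A C hv] at hr'
  simp only [Option.map_eq_some_iff] at hr hr'
  obtain ⟨s, hs, rfl⟩ := hr
  obtain ⟨s', hs', rfl⟩ := hr'
  obtain ⟨rfl, h2⟩ := h w rfl s s' hs hs'
  refine ⟨rfl, fun ψ y hy => ?_⟩
  obtain ⟨A', x, C', rfl, hA, hx⟩ := exists_split (l := y) (i := A.length) (n := s.length)
    (by simp at hy; omega)
  rw [evolve_shift q A C A' C' hA hs hx, evolve_shift q A C A' C' hA hs' hx]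
  exact h2 _ _ hx

theorem step_run_cons {w r : List Bool} {e : Slice} {D : Word} (h : run w (e :: D) = some r) :
    ∃ t, step w e = some t ∧ run t D = some r := by
  simp only [run] at h
  cases hs : step w e with
  | none => simp [hs] at h
  | some t => exact ⟨t, rfl, by simpa [hs] using h⟩

/-- The operator of an event on a level without any further strands. -/
theorem act_exact (q : K) (k : Kind) (w y : List Bool) (φ : List Bool → K)
    (hw : w.length = k.dom) (hy : y.length = k.cod) :
    act q w ⟨k, 0⟩ φ y = k.sum fun x => amp q k w x y * φ x := by
  simp [act, ← hw, ← hy]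

/-- Two distant events act on different strands, so that their operators commute. -/
theorem sound_exchange (q : K) (w : List Bool) (k l : Kind) (i m : ℕ) :
    Sound q w [⟨k, i⟩, ⟨l, i + k.cod + m⟩] [⟨l, i + k.dom + m⟩, ⟨k, i⟩] := by
  intro r r' hr hr'
  have hlen : i + (k.dom + (m + l.dom)) ≤ w.length := by
    obtain ⟨t, h1, h2⟩ := step_run_cons hr
    obtain ⟨t', h3, -⟩ := step_run_cons h2
    have := step_length h1
    have := step_length h3
    simp only at *
    omega
  obtain ⟨A, w', C, rfl, rfl, hw'⟩ := exists_split hlen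
  obtain ⟨Z, u, w'', rfl, hZ, hu⟩ := exists_split (l := w') (i := 0) (n := k.dom) (by omega)
  obtain ⟨M, v, Z', rfl, rfl, hv⟩ := exists_split (l := w'') (i := m) (n := l.dom)
    (by simp at hw'; omega)
  obtain rfl : Z = [] := List.length_eq_zero_iff.1 hZ
  obtain rfl : Z' = [] := List.length_eq_zero_iff.1 (by simp at hw'; omega)
  simp only [List.nil_append, List.append_nil] at *
  have key : ∀ (A w C : List Bool) (k : Kind) (n : ℕ), w.length = k.dom → A.length = n →
      step (A ++ w ++ C) ⟨k, n⟩ = (step w ⟨k, 0⟩).map fun r => A ++ r ++ C := by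
    rintro A w C k n hw rfl
    exact step_append A C w ⟨k, 0⟩ (by simp [hw])
  have keya : ∀ (A w C A' y C' : List Bool) (k : Kind) (n : ℕ) (ψ : List Bool → K),
      w.length = k.dom → y.length = k.cod → A.length = n → A'.length = n →
      act q (A ++ w ++ C) ⟨k, n⟩ ψ (A' ++ y ++ C') =
        k.sum fun x => amp q k w x y * ψ (A' ++ x ++ C') := by
    rintro A w C A' y C' k n ψ hw hy rfl hA
    rw [← act_exact q k w y _ hw hy]
    exact act_append q A C w A' C' y ⟨k, 0⟩ ψ hA (by simp [hw]) (by simp [hy])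
  have e1 : A ++ (u ++ (M ++ v)) ++ C = A ++ u ++ (M ++ v ++ C) := by simp
  have e2 : A ++ (u ++ (M ++ v)) ++ C = (A ++ u ++ M) ++ v ++ C := by simp
  have s1 := key A u (M ++ v ++ C) k _ hu rfl
  have s2 := key (A ++ u ++ M) v C l (A.length + k.dom + M.length) hv (by simp [hu, add_assoc])
  rw [← e1] at s1
  rw [← e2] at s2
  simp only [run, s1, s2] at hr hr'
  cases hu' : step u ⟨k, 0⟩ with
  | none => simp [hu'] at hr
  | some u' =>
  cases hv' : step v ⟨l, 0⟩ with
  | none => simp [hv'] at hr'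
  | some v' =>
  have lu := step_length hu'
  have lv := step_length hv'
  simp only [zero_add] at lu lv
  have s3 := key A u (M ++ v' ++ C) k _ hu rfl
  have s4 := key (A ++ u' ++ M) v C l (A.length + k.cod + M.length) hv (by simp; omega)
  have e3 : A ++ u ++ (M ++ v' ++ C) = A ++ u ++ M ++ v' ++ C := by simp
  have e4 : A ++ u' ++ (M ++ v ++ C) = A ++ u' ++ M ++ v ++ C := by simp
  rw [e3] at s3
  rw [← e4] at s4
  simp only [hu', hv', Option.map_some, s3, s4, Option.some.injEq] at hr hr' s1 s2 s3 s4
  subst hr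
  subst hr'
  refine ⟨by simp, fun ψ y hy => ?_⟩
  obtain ⟨A', y', C', rfl, hA', hy'⟩ := exists_split (l := y) (i := A.length)
    (n := k.cod + (M.length + l.cod)) (by simp at hy; omega)
  obtain ⟨Z, y1, y'', rfl, hZ, hy1⟩ := exists_split (l := y') (i := 0) (n := k.cod) (by omega)
  obtain ⟨M', y2, Z', rfl, hM', hy2⟩ := exists_split (l := y'') (i := M.length) (n := l.cod)
    (by simp at hy'; omega)
  obtain rfl : Z = [] := List.length_eq_zero_iff.1 hZ
  obtain rfl : Z' = [] := List.length_eq_zero_iff.1 (by simp at hy'; omega)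
  simp only [evolve, s1, s2, Option.getD_some, List.nil_append, List.append_nil] at *
  have f1 : A' ++ (y1 ++ (M' ++ y2)) ++ C' = (A' ++ y1 ++ M') ++ y2 ++ C' := by simp
  have f2 : A' ++ (y1 ++ (M' ++ y2)) ++ C' = A' ++ y1 ++ (M' ++ y2 ++ C') := by simp
  rw [e4, f1, keya _ _ _ _ _ _ _ _ _ hv hy2 (by simp; omega) (by simp; omega), ← f1, f2, ← e3,
    keya _ _ _ _ _ _ _ _ _ hu hy1 rfl hA']
  have a1 : ∀ x, x.length = l.dom →
      act q (A ++ (u ++ (M ++ v)) ++ C) ⟨k, A.length⟩ ψ (A' ++ y1 ++ M' ++ x ++ C') =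
        k.sum fun z => amp q k u z y1 * ψ (A' ++ z ++ (M' ++ x ++ C')) := by
    intro x _
    rw [e1, ← keya A u (M ++ v ++ C) A' y1 (M' ++ x ++ C') k _ ψ hu hy1 rfl hA']
    simp
  have a2 : ∀ z, z.length = k.dom →
      act q (A ++ (u ++ (M ++ v)) ++ C) ⟨l, A.length + k.dom + M.length⟩ ψ
        (A' ++ z ++ (M' ++ y2 ++ C')) =
        l.sum fun x => amp q l v x y2 * ψ (A' ++ z ++ (M' ++ x ++ C')) := by
    intro z hz
    have := keya (A ++ u ++ M) v C (A' ++ z ++ M') y2 C' l (A.length + k.dom + M.length) ψ hv hy2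
      (by simp; omega) (by simp; omega)
    rw [e2]
    simpa using this
  rw [Kind.sum_congr l fun x hx => by rw [a1 x hx, ← Kind.mul_sum],
    Kind.sum_congr k fun z hz => by rw [a2 z hz, ← Kind.mul_sum], Kind.sum_comm]
  exact Kind.sum_congr k fun z _ => Kind.sum_congr l fun x _ => by ring

theorem length_of_run {w r : List Bool} {e f : Slice} {D : Word}
    (h : run w (e :: f :: D) = some r) :
    e.pos + e.kind.dom ≤ w.length ∧ f.pos + f.kind.dom + e.kind.dom ≤ w.length + e.kind.cod := by
  obtain ⟨t, h1, h2⟩ := step_run_cons h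
  obtain ⟨t', h3, -⟩ := step_run_cons h2
  have := step_length h1
  have := step_length h3
  omega

theorem sound_reidemeister2 (hq : q ≠ 0) (w : List Bool) (i : ℕ) (s : Bool) :
    Sound q w [cross i s, cross i (!s)] [] := by
  intro r r' hr
  have hlen : i + 2 ≤ w.length := (length_of_run hr).1
  revert r r'
  refine Sound.shift (u := [cross 0 s, cross 0 (!s)]) (v := []) (n := 2) (i := i)
    (by simp [Fits, Kind.dom, Kind.cod]) trivial ?_ hlen
  intro w hw
  obtain ⟨a, b, rfl⟩ := List.length_eq_two.1 hw
  intro r r' hr hr'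
  simp [run, step] at hr hr'
  subst hr hr'
  refine ⟨rfl, fun ψ y hy => ?_⟩
  obtain ⟨x, z, rfl⟩ := List.length_eq_two.1 hy
  have h := fun x₁ x₂ => crossWeight_reidemeister2 hq s a b x₁ x₂ x z
  simp only [Fintype.sum_bool] at h
  have h1 := h true true
  have h2 := h true false
  have h3 := h false true
  have h4 := h false false
  simp [evolve, step, act, Kind.sum, amp, Kind.dom, Kind.cod]
  cases x <;> cases z <;>
    simp only [reduceCtorEq, and_true, and_self, and_false, if_true, if_false] at h1 h2 h3 h4 <;>
    linear_combination ψ [true, true] * h1 + ψ [true, false] * h2 + ψ [false, true] * h3 +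
      ψ [false, false] * h4

theorem sound_reidemeister3 (w : List Bool) (i : ℕ) {a b c : Bool} (h : b = a ∨ b = c) :
    Sound q w [cross i a, cross (i + 1) b, cross i c]
      [cross (i + 1) c, cross i b, cross (i + 1) a] := by
  intro r r' hr
  have hlen : i + 3 ≤ w.length := by
    have := length_of_run hr
    simp only [Kind.dom, Kind.cod] at this
    omega
  revert r r'
  refine Sound.shift (u := [cross 0 a, cross 1 b, cross 0 c])
    (v := [cross 1 c, cross 0 b, cross 1 a]) (n := 3) (i := i)
    (by simp [Fits, Kind.dom, Kind.cod]) (by simp [Fits, Kind.dom, Kind.cod]) ?_ hlen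
  intro w hw
  obtain ⟨o₁, o₂, o₃, rfl⟩ := List.length_eq_three.1 hw
  intro r r' hr hr'
  simp [run, step] at hr hr'
  subst hr hr'
  refine ⟨rfl, fun ψ y hy => ?_⟩
  obtain ⟨y₁, y₂, y₃, rfl⟩ := List.length_eq_three.1 hy
  have h := fun x₁ x₂ x₃ => crossWeight_reidemeister3 (q := q) h o₁ o₂ o₃ x₁ x₂ x₃ y₁ y₂ y₃
  simp [evolve, step, act, Kind.sum, amp, Kind.dom, Kind.cod]
  simp only [Fintype.sum_bool] at h ⊢
  linear_combination ψ [true, true, true] * h true true true +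
    ψ [true, true, false] * h true true false + ψ [true, false, true] * h true false true +
    ψ [true, false, false] * h true false false + ψ [false, true, true] * h false true true +
    ψ [false, true, false] * h false true false + ψ [false, false, true] * h false false true +
    ψ [false, false, false] * h false false false

theorem sound_zigzagLeft (hq : q ≠ 0) (w : List Bool) (i : ℕ) (b : Bool) :
    Sound q w [cup i b, cap (i + 1)] [] := by
  intro r r' hr
  have hlen : i + 1 ≤ w.length := by
    have := length_of_run hr
    simp only [Kind.dom, Kind.cod] at this
    omega
  revert r r'
  refine Sound.shift (u := [cup 0 b, cap 1]) (v := []) (n := 1) (i := i)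
    (by simp [Fits, Kind.dom, Kind.cod]) trivial ?_ hlen
  intro w hw
  obtain ⟨a, rfl⟩ := List.length_eq_one_iff.1 hw
  intro r r' hr hr'
  obtain rfl : a = b := by
    by_contra hab
    have : (!b) = a := by cases a <;> cases b <;> simp_all
    simp [run, step, this] at hr
  simp [run, step] at hr hr'
  subst hr hr'
  refine ⟨rfl, fun ψ y hy => ?_⟩
  obtain ⟨x, rfl⟩ := List.length_eq_one_iff.1 hy
  have h := capWeight_mul_cupWeight hq a x
  simp [evolve, step, act, Kind.sum, amp, Kind.dom, Kind.cod]
  linear_combination ψ [x] * h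

theorem sound_zigzagRight (hq : q ≠ 0) (w : List Bool) (i : ℕ) (b : Bool) :
    Sound q w [cup (i + 1) b, cap i] [] := by
  intro r r' hr
  have hlen : i + 1 ≤ w.length := by
    have := length_of_run hr
    simp only [Kind.dom, Kind.cod] at this
    omega
  revert r r'
  refine Sound.shift (u := [cup 1 b, cap 0]) (v := []) (n := 1) (i := i)
    (by simp [Fits, Kind.dom, Kind.cod]) trivial ?_ hlen
  intro w hw
  obtain ⟨a, rfl⟩ := List.length_eq_one_iff.1 hw
  intro r r' hr hr'
  obtain rfl : a = !b := by
    by_contra hab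
    have : a = b := by cases a <;> cases b <;> simp_all
    simp [run, step, this] at hr
  simp [run, step] at hr hr'
  subst hr hr'
  refine ⟨rfl, fun ψ y hy => ?_⟩
  obtain ⟨x, rfl⟩ := List.length_eq_one_iff.1 hy
  have h := capWeight_mul_cupWeight hq b x
  simp [evolve, step, act, Kind.sum, amp, Kind.dom, Kind.cod]
  linear_combination ψ [x] * h

theorem sound_reidemeister1Cup (hq : q ≠ 0) (w : List Bool) (i : ℕ) (b s : Bool) :
    Sound q w [cup i b, cross i s] [cup i (!b)] := by
  intro r r' hr
  have hlen : i + 0 ≤ w.length := by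
    have := length_of_run hr
    simp only [Kind.dom, Kind.cod] at this
    omega
  revert r r'
  refine Sound.shift (u := [cup 0 b, cross 0 s]) (v := [cup 0 (!b)]) (n := 0) (i := i)
    (by simp [Fits, Kind.dom, Kind.cod]) (by simp [Fits, Kind.dom]) ?_ hlen
  intro w hw
  obtain rfl := List.length_eq_zero_iff.1 hw
  intro r r' hr hr'
  simp [run, step] at hr hr'
  subst hr hr'
  refine ⟨by simp, fun ψ y hy => ?_⟩
  obtain ⟨x, z, rfl⟩ := List.length_eq_two.1 hy
  have h := crossWeight_cup hq s b x z
  simp [evolve, step, act, Kind.sum, amp, Kind.dom, Kind.cod]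
  simp only [Fintype.sum_bool] at h
  split_ifs at h ⊢ <;> linear_combination ψ [] * h

theorem sound_reidemeister1Cap (hq : q ≠ 0) (w : List Bool) (i : ℕ) (s : Bool) :
    Sound q w [cross i s, cap i] [cap i] := by
  intro r r' hr
  have hlen : i + 2 ≤ w.length := by
    have := length_of_run hr
    simp only [Kind.dom, Kind.cod] at this
    omega
  revert r r'
  refine Sound.shift (u := [cross 0 s, cap 0]) (v := [cap 0]) (n := 2) (i := i)
    (by simp [Fits, Kind.dom, Kind.cod]) (by simp [Fits, Kind.dom]) ?_ hlen
  intro w hw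
  obtain ⟨a, b, rfl⟩ := List.length_eq_two.1 hw
  intro r r' hr hr'
  obtain rfl : b = !a := by
    by_contra hab
    have : a = b := by cases a <;> cases b <;> simp_all
    simp [run, step, this] at hr
  simp [run, step] at hr hr'
  subst hr hr'
  refine ⟨rfl, fun ψ y hy => ?_⟩
  obtain rfl := List.length_eq_zero_iff.1 hy
  have h := fun x z => crossWeight_cap hq s a x z
  simp [evolve, step, act, Kind.sum, amp, Kind.dom, Kind.cod]
  simp only [Fintype.sum_bool] at h
  have h1 := h true true
  have h2 := h true false
  have h3 := h false true
  have h4 := h false false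
  simp only [reduceCtorEq, if_true, if_false] at h1 h2 h3 h4
  linear_combination ψ [true, true] * h1 + ψ [true, false] * h2 + ψ [false, true] * h3 +
    ψ [false, false] * h4

theorem sound_slideCup (w : List Bool) (i : ℕ) (b s : Bool) :
    Sound q w [cup i b, cross (i + 1) s] [cup (i + 1) b, cross i (!s)] := by
  intro r r' hr
  have hlen : i + 1 ≤ w.length := by
    have := length_of_run hr
    simp only [Kind.dom, Kind.cod] at this
    omega
  revert r r'
  refine Sound.shift (u := [cup 0 b, cross 1 s]) (v := [cup 1 b, cross 0 (!s)]) (n := 1) (i := i)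
    (by simp [Fits, Kind.dom, Kind.cod]) (by simp [Fits, Kind.dom, Kind.cod]) ?_ hlen
  intro w hw
  obtain ⟨c, rfl⟩ := List.length_eq_one_iff.1 hw
  intro r r' hr hr'
  simp [run, step] at hr hr'
  subst hr hr'
  refine ⟨rfl, fun ψ y hy => ?_⟩
  obtain ⟨p, x, z, rfl⟩ := List.length_eq_three.1 hy
  have h := fun t => crossWeight_slideCup (q := q) s b c p t x z
  simp [evolve, step, act, Kind.sum, amp, Kind.dom, Kind.cod]
  linear_combination ψ [true] * h true + ψ [false] * h false

theorem sound_slideCap (w : List Bool) (i : ℕ) (s : Bool) :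
    Sound q w [cross i s, cap (i + 1)] [cross (i + 1) (!s), cap i] := by
  intro r r' hr
  have hlen : i + 3 ≤ w.length := by
    have := length_of_run hr
    simp only [Kind.dom, Kind.cod] at this
    omega
  revert r r'
  refine Sound.shift (u := [cross 0 s, cap 1]) (v := [cross 1 (!s), cap 0]) (n := 3) (i := i)
    (by simp [Fits, Kind.dom, Kind.cod]) (by simp [Fits, Kind.dom, Kind.cod]) ?_ hlen
  intro w hw
  obtain ⟨a, b, c, rfl⟩ := List.length_eq_three.1 hw
  intro r r' hr hr'
  obtain rfl : c = !a := by
    by_contra hab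
    have : a = c := by cases a <;> cases c <;> simp_all
    simp [run, step, this] at hr
  simp [run, step] at hr hr'
  subst hr hr'
  refine ⟨rfl, fun ψ y hy => ?_⟩
  obtain ⟨t, rfl⟩ := List.length_eq_one_iff.1 hy
  have h := fun x y z => crossWeight_slideCap (q := q) s a b x y z t
  simp [evolve, step, act, Kind.sum, amp, Kind.dom, Kind.cod]
  linear_combination ψ [true, true, true] * h true true true +
    ψ [true, true, false] * h true true false + ψ [true, false, true] * h true false true +
    ψ [true, false, false] * h true false false + ψ [false, true, true] * h false true true +
    ψ [false, true, false] * h false true false + ψ [false, false, true] * h false false true +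
    ψ [false, false, false] * h false false false

theorem Move.sound (hq : q ≠ 0) {u v : Word} (h : Move u v) (w : List Bool) : Sound q w u v := by
  cases h with
  | exchange p r i k => exact sound_exchange q w p r i k
  | zigzagLeft i b => exact sound_zigzagLeft hq w i b
  | zigzagRight i b => exact sound_zigzagRight hq w i b
  | reidemeister1Cup i b s => exact sound_reidemeister1Cup hq w i b s
  | reidemeister1Cap i s => exact sound_reidemeister1Cap hq w i s
  | reidemeister2 i s => exact sound_reidemeister2 hq w i s
  | reidemeister3 i a b c h => exact sound_reidemeister3 w i h
  | slideCup i b s => exact sound_slideCup w i b s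
  | slideCap i s => exact sound_slideCap w i s

/-! ### Uniqueness of the Conway polynomial -/

/-- The state sum of a long diagram, both ends of the open strand carrying the label `false`.  The
diagram has to be cut open: the state sum of a closed diagram would vanish. -/
def value (q : K) (D : Word) : K :=
  evolve q [true] D (fun x => if x = [false] then 1 else 0) [false]

theorem run_append_eq_some {w r : List Bool} {D E : Word} :
    run w (D ++ E) = some r ↔ ∃ t, run w D = some t ∧ run t E = some r := by
  rw [run_append, Option.bind_eq_some_iff]

theorem value_append (q : K) {x u y : Word} {w r : List Bool} (hx : run [true] x = some w)
    (hu : run w u = some r) :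
    value q (x ++ u ++ y) = evolve q r y
      (evolve q w u (evolve q [true] x fun x => if x = [false] then 1 else 0)) [false] := by
  rw [value, evolve_append q (run_append_eq_some.2 ⟨w, hx, hu⟩), evolve_append q hx]

theorem MoveIn.value_eq (hq : q ≠ 0) {D E : Word} (h : MoveIn D E) : value q D = value q E := by
  obtain ⟨x, y, u, v, h, hu, hv⟩ := h
  obtain ⟨r, hu, hy⟩ := run_append_eq_some.1 hu
  obtain ⟨w, hx, hu⟩ := run_append_eq_some.1 hu
  obtain ⟨r', hv, hy'⟩ := run_append_eq_some.1 hv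
  obtain ⟨w', hx', hv⟩ := run_append_eq_some.1 hv
  obtain rfl : w = w' := by simpa [hx] using hx'
  obtain ⟨rfl, h⟩ := h.sound hq w r r' hu hv
  rw [value_append q hx hu, value_append q hx hv]
  exact evolve_congr q hy (fun z hz => h _ z hz) _ rfl

theorem Isotopic.value_eq (hq : q ≠ 0) {D E : Word} (h : Isotopic D E) :
    value q D = value q E := by
  induction h with
  | rel _ _ h => exact h.value_eq hq
  | refl => rfl
  | symm _ _ _ ih => exact ih.symm
  | trans _ _ _ _ _ ih₁ ih₂ => exact ih₁.trans ih₂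

/-- The skein relation between the operators of the two crossings and of the resolution. -/
theorem evolve_cross (hq : q ≠ 0) (w : List Bool) (i : ℕ) (a b : Bool) (ha : w[i]? = some a)
    (hb : w[i + 1]? = some b) (ψ : List Bool → K) (y : List Bool) (hy : y.length = w.length) :
    evolve q w [cross i (a == b)] ψ y = evolve q w [cross i (!(a == b))] ψ y +
      (q - q⁻¹) * evolve q w (resolution i a b) ψ y := by
  have hlen : i + 2 ≤ w.length := (List.getElem?_eq_some_iff.1 hb).1
  obtain ⟨A, w, C, rfl, rfl, hw⟩ := exists_split hlen
  obtain ⟨c, d, rfl⟩ := List.length_eq_two.1 hw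
  obtain rfl : c = a := by simpa using ha
  obtain rfl : d = b := by simpa using hb
  obtain ⟨A', y, C', rfl, hA, hy'⟩ := exists_split (l := y) (i := A.length) (n := 2)
    (by simp at hy; omega)
  have key : ∀ s, evolve q (A ++ [c, d] ++ C) [cross A.length s] ψ (A' ++ y ++ C') =
      evolve q [c, d] [cross 0 s] (fun x => ψ (A' ++ x ++ C')) y := fun s =>
    evolve_shift q A C A' C' hA (w := [c, d]) (D := [cross 0 s]) (r := [d, c]) rfl hy' ψ
  have hres : run [c, d] (resolution 0 c d) = some [d, c] := by
    cases c <;> cases d <;> rfl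
  have key' : evolve q (A ++ [c, d] ++ C) (resolution A.length c d) ψ (A' ++ y ++ C') =
      evolve q [c, d] (resolution 0 c d) (fun x => ψ (A' ++ x ++ C')) y := by
    rw [← evolve_shift q A C A' C' hA hres hy' ψ]
    congr 1
    cases c <;> cases d <;> rfl
  rw [key, key, key']
  obtain ⟨y₁, y₂, rfl⟩ := List.length_eq_two.1 hy'
  generalize (fun x => ψ (A' ++ x ++ C')) = φ
  by_cases hcd : c = d
  · subst hcd
    have h := fun x z => crossWeight_skein_parallel hq c x z y₁ y₂
    have h1 := h true true
    have h2 := h true false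
    have h3 := h false true
    have h4 := h false false
    simp [evolve, act, Kind.sum, amp, Kind.dom, Kind.cod, resolution]
    cases y₁ <;> cases y₂ <;>
      simp only [reduceCtorEq, and_true, and_self, and_false, if_true, if_false]
        at h1 h2 h3 h4 <;>
      linear_combination φ [true, true] * h1 + φ [true, false] * h2 + φ [false, true] * h3 +
        φ [false, false] * h4
  · obtain rfl : d = !c := by cases c <;> cases d <;> simp_all
    have h := fun x z => crossWeight_skein_antiparallel hq c x z y₁ y₂
    have h1 := h true true
    have h2 := h true false
    have h3 := h false true
    have h4 := h false false
    simp [evolve, step, act, Kind.sum, amp, Kind.dom, Kind.cod, resolution]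
    cases y₁ <;> cases y₂ <;>
      simp only [reduceCtorEq, and_true, and_self, and_false, if_true, if_false]
        at h1 h2 h3 h4 ⊢ <;>
      linear_combination φ [true, true] * h1 + φ [true, false] * h2 + φ [false, true] * h3 +
        φ [false, false] * h4

theorem SkeinTriple.value_eq (hq : q ≠ 0) {P M O : Word} (h : SkeinTriple P M O) :
    value q P = value q M + (q - q⁻¹) * value q O := by
  obtain ⟨x, y, w, i, a, b, hx, ha, hb, hD⟩ := h
  obtain ⟨r, hu, hy⟩ := run_append_eq_some.1 hD
  obtain ⟨w', hx', hu⟩ := run_append_eq_some.1 hu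
  obtain rfl : w = w' := by simpa [hx] using hx'
  have hlen : r.length = w.length := by
    obtain ⟨t, h1, h2⟩ := step_run_cons hu
    obtain rfl : t = r := by simpa [run] using h2
    exact Nat.add_right_cancel (step_length h1).2
  have hv : run w [cross i (!(a == b))] = some r := hu
  have ho : run w (resolution i a b) = some r := by
    have hlen : i + 2 ≤ w.length := (List.getElem?_eq_some_iff.1 hb).1
    obtain ⟨A, w, C, rfl, rfl, hw⟩ := exists_split hlen
    obtain ⟨c, d, rfl⟩ := List.length_eq_two.1 hw
    obtain rfl : c = a := by simpa using ha
    obtain rfl : d = b := by simpa using hb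
    rw [← hu]
    by_cases hcd : c = d
    · subst hcd
      simp [resolution, run, step]
    · simp [resolution, run, step, hcd]
      cases c <;> cases d <;> simp_all
  rw [value_append q hx hu, value_append q hx hv, value_append q hx ho]
  have := evolve_linear q r y (q - q⁻¹)
    (evolve q w [cross i (!(a == b))] (evolve q [true] x fun x => if x = [false] then 1 else 0))
    (evolve q w (resolution i a b) (evolve q [true] x fun x => if x = [false] then 1 else 0))
  rw [← congrFun this]
  exact evolve_congr q hy (fun z hz => evolve_cross hq w i a b ha hb _ z (hz.trans hlen)) _ rfl

theorem HasConway.value_eq (hq : q ≠ 0) (hz : q⁻¹ - q ≠ 0) {D : Word} {p : ℤ[X]}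
    (h : HasConway D p) : value q D = aeval (q⁻¹ - q) p := by
  induction h with
  | unknot => simp [value, evolve]
  | isotopy h _ ih => rw [← h.value_eq hq, ih]
  | positive h _ _ e ihM ihO =>
    have := congrArg (aeval (q⁻¹ - q)) e
    simp only [map_sub, map_mul, map_neg, aeval_X] at this
    linear_combination h.value_eq hq + ihM + (q - q⁻¹) * ihO - this
  | negative h _ _ e ihP ihO =>
    have := congrArg (aeval (q⁻¹ - q)) e
    simp only [map_sub, map_mul, map_neg, aeval_X] at this
    linear_combination -h.value_eq hq + ihP - (q - q⁻¹) * ihO + this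
  | resolved h _ _ e ihP ihM =>
    have := congrArg (aeval (q⁻¹ - q)) e
    simp only [map_sub, map_mul, map_neg, aeval_X] at this
    refine mul_left_cancel₀ hz ?_
    linear_combination h.value_eq hq - ihP + ihM - this

/-- The relation `z = q⁻¹ - q` takes infinitely many values, and at each of them the state sum
determines the polynomial. -/
theorem HasConway.unique {D : Word} {p p' : ℤ[X]} (h : HasConway D p) (h' : HasConway D p') :
    p = p' := by
  refine map_injective (Int.castRingHom ℚ) Int.cast_injective ?_
  refine eq_of_infinite_eval_eq _ _ (Set.infinite_of_injective_forall_mem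
    (f := fun n : ℕ => ((n : ℚ) + 2)⁻¹ - (n + 2)) ?_ ?_)
  · refine StrictAnti.injective fun m n hmn => ?_
    have : (m : ℚ) < n := by exact_mod_cast hmn
    have : ((n : ℚ) + 2)⁻¹ < ((m : ℚ) + 2)⁻¹ := by gcongr
    linarith
  · intro n
    -- `q = n + 2` makes `z = q⁻¹ - q` nonzero, so that `∇(O)` can be cancelled from `z ∇(O)`.
    have hq : (n : ℚ) + 2 ≠ 0 := by positivity
    have hz : ((n : ℚ) + 2)⁻¹ - (n + 2) ≠ 0 := by
      have : ((n : ℚ) + 2)⁻¹ < 1 := inv_lt_one_of_one_lt₀ (by linarith [n.cast_nonneg (α := ℚ)])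
      have := n.cast_nonneg (α := ℚ)
      linarith
    have := (h.value_eq hq hz).symm.trans (h'.value_eq hq hz)
    simpa [eval_map, aeval_def] using this

theorem HasConway.conway_eq {D : Word} {p : ℤ[X]} (h : HasConway D p) : conway D = p := by
  have hu : ∃! p, HasConway D p := ⟨p, h, fun _ h' => h'.unique h⟩
  rw [conway, dif_pos hu]
  exact hu.choose_spec.1.unique h

/-! ### Isotopy of tangle diagrams -/

/-- Isotopy of tangle diagrams that start at the level `w`; the upper level is kept fixed. -/
def TangleIsotopic (w : List Bool) : Word → Word → Prop :=
  Relation.EqvGen fun D E => ∃ x y u v, Move u v ∧ D = x ++ u ++ y ∧ E = x ++ v ++ y ∧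
    run w D = run w E ∧ (run w D).isSome

namespace TangleIsotopic

variable {w w' r : List Bool} {D E F u v x y : Word}

theorem refl (D : Word) : TangleIsotopic w D D := Relation.EqvGen.refl D

theorem symm (h : TangleIsotopic w D E) : TangleIsotopic w E D := Relation.EqvGen.symm _ _ h

theorem trans (h : TangleIsotopic w D E) (h' : TangleIsotopic w E F) : TangleIsotopic w D F :=
  Relation.EqvGen.trans _ _ _ h h'

instance : Trans (TangleIsotopic w) (TangleIsotopic w) (TangleIsotopic w) := ⟨trans⟩

/-- The move `u → v` performed after the first `k` events of `D`. -/
theorem move (k : ℕ) (h : Move u v) (hD : D.take k ++ u ++ D.drop (k + u.length) = D := by rfl)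
    (hE : D.take k ++ v ++ D.drop (k + u.length) = E := by rfl)
    (hr : run w D = run w E := by rfl) (hs : (run w D).isSome := by rfl) :
    TangleIsotopic w D E :=
  .rel _ _ ⟨_, _, u, v, h, hD.symm, hE.symm, hr, hs⟩

theorem run_eq (h : TangleIsotopic w D E) : run w D = run w E := by
  induction h with
  | rel _ _ h => obtain ⟨_, _, _, _, -, -, -, h, -⟩ := h; exact h
  | refl => rfl
  | symm _ _ _ ih => exact ih.symm
  | trans _ _ _ _ _ ih₁ ih₂ => exact ih₁.trans ih₂

theorem context (x y : Word) (h : TangleIsotopic w' D E) (hx : run w x = some w')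
    (hD : run w' D = some r) (hy : (run r y).isSome) :
    TangleIsotopic w (x ++ D ++ y) (x ++ E ++ y) := by
  induction h with
  | rel D E h =>
    obtain ⟨a, b, u, v, h, rfl, rfl, he, hs⟩ := h
    refine .rel _ _ ⟨x ++ a, b ++ y, u, v, h, by simp, by simp, ?_, ?_⟩
    · simp only [run_append] at he ⊢
      simp [hx, he]
    · simp only [run_append] at hD ⊢
      simp [hx, hD, hy]
  | refl => exact refl _
  | symm D E h ih => exact (ih (by rw [← hD]; exact run_eq h)).symm
  | trans D E F h₁ h₂ ih₁ ih₂ =>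
    exact (ih₁ hD).trans (ih₂ (by rw [← hD]; exact (run_eq h₁).symm))

theorem isotopic (h : TangleIsotopic [true] D E) (hD : IsDiagram D) : Isotopic D E := by
  induction h with
  | rel D E h =>
    obtain ⟨a, b, u, v, h, rfl, rfl, he, hs⟩ := h
    exact .rel _ _ ⟨a, b, u, v, h, hD, he.symm.trans hD⟩
  | refl => exact .refl _
  | symm D E h ih => exact (ih ((run_eq h).trans hD)).symm
  | trans D E F h₁ h₂ ih₁ ih₂ => exact (ih₁ hD).trans _ _ _ (ih₂ ((run_eq h₁).symm.trans hD))

theorem hasConway {p : ℤ[X]} (h : TangleIsotopic [true] D E) (hE : HasConway E p)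
    (hD : IsDiagram D := by rfl) : HasConway D p :=
  .isotopy ((h.isotopic hD).symm _ _) hE

end TangleIsotopic

/-- The level of the three strands of the braid-like part of a closure (upwards, downwards,
downwards) and of the two strands that lead back. -/
abbrev threeStrands : List Bool := [true, false, false, true, true]

/-- The closure of a tangle on three strands as a long diagram: the second and the third strand are
closed on the right, the first one through infinity. -/
def closure (B : Word) : Word := [cup 1 false, cup 2 false] ++ B ++ [cap 2, cap 1]

theorem TangleIsotopic.closure {B C : Word}
    (h : TangleIsotopic threeStrands B C)
    (hB : run [true, false, false, true, true] B = some [true, false, false, true, true] :=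
      by rfl) :
    TangleIsotopic [true] (closure B) (closure C) :=
  h.context _ _ rfl hB rfl

/-! ### Braid-like tangles -/

/-- The full twist as the product of the two full twists of the first strand around the others. -/
theorem leftFullTwistThree_isotopic :
    TangleIsotopic threeStrands leftFullTwistThree
      [cross 0 false, cross 0 false, cross 1 false, cross 0 false, cross 0 false,
        cross 1 false] :=
  .symm (.move 1 (.reidemeister3 0 false false false (.inl rfl)))

theorem cross_leftFullTwistThree_isotopic :
    TangleIsotopic threeStrands (cross 1 true :: leftFullTwistThree)
      [cross 0 false, cross 0 false, cross 1 false, cross 0 false, cross 0 false] :=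
  calc
    TangleIsotopic threeStrands (cross 1 true :: leftFullTwistThree)
      [cross 1 true, cross 1 false, cross 0 false, cross 1 false, cross 1 false, cross 0 false,
        cross 1 false] := .move 1 (.reidemeister3 0 false false false (.inl rfl))
    TangleIsotopic threeStrands _
      [cross 0 false, cross 1 false, cross 1 false, cross 0 false, cross 1 false] :=
        .move 0 (.reidemeister2 1 true)
    TangleIsotopic threeStrands _
      [cross 0 false, cross 1 false, cross 0 false, cross 1 false, cross 0 false] :=
        .symm (.move 2 (.reidemeister3 0 false false false (.inl rfl)))
    TangleIsotopic threeStrands _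
      [cross 0 false, cross 0 false, cross 1 false, cross 0 false, cross 0 false] :=
        .symm (.move 1 (.reidemeister3 0 false false false (.inl rfl)))

/-- A turnback absorbs the crossings of its own two strands and slides off the third strand. -/
theorem turnback_isotopic :
    TangleIsotopic threeStrands
      [cap 0, cup 0 true, cross 0 false, cross 0 false, cross 1 false, cross 0 false,
        cross 0 false]
      [cap 0, cup 0 true, cross 1 true] :=
  calc
    TangleIsotopic threeStrands
      [cap 0, cup 0 true, cross 0 false, cross 0 false, cross 1 false, cross 0 false,
        cross 0 false]
      [cap 0, cup 0 false, cross 0 false, cross 1 false, cross 0 false, cross 0 false] :=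
        .move 1 (.reidemeister1Cup 0 true false)
    TangleIsotopic threeStrands _
      [cap 0, cup 0 true, cross 1 false, cross 0 false, cross 0 false] :=
        .move 1 (.reidemeister1Cup 0 false false)
    TangleIsotopic threeStrands _ [cap 0, cup 1 true, cross 0 true, cross 0 false, cross 0 false] :=
        .move 1 (.slideCup 0 true false)
    TangleIsotopic threeStrands _ [cap 0, cup 1 true, cross 0 false] :=
      .move 2 (.reidemeister2 0 true)
    TangleIsotopic threeStrands _ [cap 0, cup 0 true, cross 1 true] :=
        .symm (.move 1 (.slideCup 0 true true))

/-- Once the upward leg of the local minimum runs over both strands, it can be moved to the left of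
them. -/
theorem passOver_isotopic :
    TangleIsotopic threeStrands
      [cup 2 true, cross 1 false, cross 0 false, cap 1] [cap 0, cup 0 true] :=
  calc
    TangleIsotopic threeStrands
      [cup 2 true, cross 1 false, cross 0 false, cap 1]
      [cup 1 true, cross 2 true, cross 0 false, cap 1] := .symm (.move 0 (.slideCup 1 true true))
    TangleIsotopic threeStrands _ [cup 1 true, cross 0 false, cross 2 true, cap 1] :=
      .symm (.move 1 (.exchange (.cross false) (.cross true) 0 0))
    TangleIsotopic threeStrands _ [cup 0 true, cross 1 true, cross 2 true, cap 1] :=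
      .symm (.move 0 (.slideCup 0 true true))
    TangleIsotopic threeStrands _ [cup 0 true, cross 1 true, cross 1 false, cap 2] :=
      .symm (.move 2 (.slideCap 1 false))
    TangleIsotopic threeStrands _ [cup 0 true, cap 2] := .move 1 (.reidemeister2 1 true)
    TangleIsotopic threeStrands _ [cap 0, cup 0 true] := .move 0 (.exchange (.cup true) .cap 0 0)

/-! ### Conway polynomials of the diagrams in the skein tree -/

/-- An unlink of two components; it is the resolution of two diagrams of the unknot with one
kink. -/
theorem HasConway.split_right : HasConway [cup 1 false, cap 1] 0 := by
  have hP : HasConway [cup 1 true, cross 0 true, cap 1] 1 :=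
    TangleIsotopic.hasConway (calc
      TangleIsotopic [true] [cup 1 true, cross 0 true, cap 1] [cup 0 true, cross 1 false, cap 1] :=
        .symm (.move 0 (.slideCup 0 true false))
      TangleIsotopic [true] _ [cup 0 true, cap 1] := .move 1 (.reidemeister1Cap 1 false)
      TangleIsotopic [true] _ [] := .move 0 (.zigzagLeft 0 true)) .unknot
  have hM : HasConway [cup 1 true, cross 0 false, cap 1] 1 :=
    TangleIsotopic.hasConway (calc
      TangleIsotopic [true] [cup 1 true, cross 0 false, cap 1] [cup 0 true, cross 1 true, cap 1] :=
        .symm (.move 0 (.slideCup 0 true true))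
      TangleIsotopic [true] _ [cup 0 true, cap 1] := .move 1 (.reidemeister1Cap 1 true)
      TangleIsotopic [true] _ [] := .move 0 (.zigzagLeft 0 true)) .unknot
  have hO : HasConway [cup 1 true, cap 1] 0 :=
    .resolved (.mk [cup 1 true] [cap 1] [true, true, false] 0 true true rfl rfl rfl rfl) hP hM
      (by ring)
  refine TangleIsotopic.hasConway (calc
    TangleIsotopic [true] [cup 1 false, cap 1] [cup 1 true, cross 1 true, cap 1] :=
      .symm (.move 0 (.reidemeister1Cup 1 true true))
    TangleIsotopic [true] _ [cup 1 true, cap 1] := .move 1 (.reidemeister1Cap 1 true)) hO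

theorem HasConway.split_left : HasConway [cup 0 false, cap 0] 0 := by
  have hP : HasConway [cup 0 false, cross 1 true, cap 0] 1 :=
    TangleIsotopic.hasConway (calc
      TangleIsotopic [true] [cup 0 false, cross 1 true, cap 0]
        [cup 1 false, cross 0 false, cap 0] := .move 0 (.slideCup 0 false true)
      TangleIsotopic [true] _ [cup 1 false, cap 0] := .move 1 (.reidemeister1Cap 0 false)
      TangleIsotopic [true] _ [] := .move 0 (.zigzagRight 0 false)) .unknot
  have hM : HasConway [cup 0 false, cross 1 false, cap 0] 1 :=
    TangleIsotopic.hasConway (calc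
      TangleIsotopic [true] [cup 0 false, cross 1 false, cap 0]
        [cup 1 false, cross 0 true, cap 0] := .move 0 (.slideCup 0 false false)
      TangleIsotopic [true] _ [cup 1 false, cap 0] := .move 1 (.reidemeister1Cap 0 true)
      TangleIsotopic [true] _ [] := .move 0 (.zigzagRight 0 false)) .unknot
  exact .resolved (.mk [cup 0 false] [cap 0] [false, true, true] 1 true true rfl rfl rfl rfl) hP hM
    (by ring)

theorem HasConway.hopf :
    HasConway [cup 1 false, cross 0 false, cross 0 false, cap 1] (-X) := by
  have hM : HasConway [cup 1 false, cross 0 true, cross 0 false, cap 1] 0 :=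
    TangleIsotopic.hasConway (.move 1 (.reidemeister2 0 true)) split_right
  have hO : HasConway [cup 1 false, cap 0, cup 0 false, cross 0 false, cap 1] 1 :=
    TangleIsotopic.hasConway (calc
      TangleIsotopic [true] [cup 1 false, cap 0, cup 0 false, cross 0 false, cap 1]
        [cup 0 false, cross 0 false, cap 1] := .move 0 (.zigzagRight 0 false)
      TangleIsotopic [true] _ [cup 0 true, cap 1] := .move 0 (.reidemeister1Cup 0 false false)
      TangleIsotopic [true] _ [] := .move 0 (.zigzagLeft 0 true)) .unknot
  exact .positive (.mk [cup 1 false] [cross 0 false, cap 1] [true, false, true] 0 true false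
    rfl rfl rfl rfl) hM hO (by ring)

/-- The torus link `T(2, 4)` with antiparallel strands. -/
theorem HasConway.torusLink :
    HasConway [cup 1 false, cross 0 false, cross 0 false, cross 0 false, cross 0 false, cap 1]
      (-2 * X) := by
  have hM : HasConway [cup 1 false, cross 0 true, cross 0 false, cross 0 false, cross 0 false,
      cap 1] (-X) :=
    TangleIsotopic.hasConway (.move 1 (.reidemeister2 0 true)) hopf
  have hO : HasConway [cup 1 false, cap 0, cup 0 false, cross 0 false, cross 0 false,
      cross 0 false, cap 1] 1 :=
    TangleIsotopic.hasConway (calc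
      TangleIsotopic [true] [cup 1 false, cap 0, cup 0 false, cross 0 false, cross 0 false,
          cross 0 false, cap 1]
        [cup 0 false, cross 0 false, cross 0 false, cross 0 false, cap 1] :=
          .move 0 (.zigzagRight 0 false)
      TangleIsotopic [true] _ [cup 0 true, cross 0 false, cross 0 false, cap 1] :=
        .move 0 (.reidemeister1Cup 0 false false)
      TangleIsotopic [true] _ [cup 0 false, cross 0 false, cap 1] :=
        .move 0 (.reidemeister1Cup 0 true false)
      TangleIsotopic [true] _ [cup 0 true, cap 1] := .move 0 (.reidemeister1Cup 0 false false)
      TangleIsotopic [true] _ [] := .move 0 (.zigzagLeft 0 true)) .unknot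
  exact .positive (.mk [cup 1 false] [cross 0 false, cross 0 false, cross 0 false, cap 1]
    [true, false, true] 0 true false rfl rfl rfl rfl) hM hO (by ring)

/-- The third strand of this braid can be removed by the first Reidemeister move. -/
theorem HasConway.closure_torusLink :
    HasConway (closure [cross 0 false, cross 0 false, cross 1 false, cross 0 false, cross 0 false])
      (-2 * X) :=
  TangleIsotopic.hasConway (calc
    TangleIsotopic [true]
      (closure [cross 0 false, cross 0 false, cross 1 false, cross 0 false, cross 0 false])
      [cup 1 false, cross 0 false, cup 2 false, cross 0 false, cross 1 false, cross 0 false,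
        cross 0 false, cap 2, cap 1] :=
      .symm (.move 1 (.exchange (.cross false) (.cup false) 0 0))
    TangleIsotopic [true] _ [cup 1 false, cross 0 false, cross 0 false, cup 2 false, cross 1 false,
        cross 0 false, cross 0 false, cap 2, cap 1] :=
      .symm (.move 2 (.exchange (.cross false) (.cup false) 0 0))
    TangleIsotopic [true] _ [cup 1 false, cross 0 false, cross 0 false, cup 2 false, cross 1 false,
        cross 0 false, cap 2, cross 0 false, cap 1] :=
      .move 6 (.exchange (.cross false) .cap 0 0)
    TangleIsotopic [true] _ [cup 1 false, cross 0 false, cross 0 false, cup 2 false, cross 1 false,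
        cap 2, cross 0 false, cross 0 false, cap 1] :=
      .move 5 (.exchange (.cross false) .cap 0 0)
    TangleIsotopic [true] _ [cup 1 false, cross 0 false, cross 0 false, cup 1 false, cross 2 true,
        cap 2, cross 0 false, cross 0 false, cap 1] :=
      .symm (.move 3 (.slideCup 1 false true))
    TangleIsotopic [true] _ [cup 1 false, cross 0 false, cross 0 false, cup 1 false,
        cap 2, cross 0 false, cross 0 false, cap 1] :=
      .move 4 (.reidemeister1Cap 2 true)
    TangleIsotopic [true] _ [cup 1 false, cross 0 false, cross 0 false, cross 0 false,
        cross 0 false, cap 1] :=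
      .move 3 (.zigzagLeft 1 false)) torusLink

/-- The third strand is split off; the diagram is the resolution of two diagrams of the Hopf link in
which the third strand forms a kink instead. -/
theorem HasConway.closure_split : HasConway (closure [cross 0 false, cross 0 false]) 0 := by
  have h : ∀ s, HasConway (closure [cross 0 false, cross 0 false, cross 1 s]) (-X) := fun s =>
    TangleIsotopic.hasConway (calc
      TangleIsotopic [true] (closure [cross 0 false, cross 0 false, cross 1 s])
        [cup 1 false, cross 0 false, cup 2 false, cross 0 false, cross 1 s, cap 2, cap 1] :=
        .symm (.move 1 (.exchange (.cross false) (.cup false) 0 0))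
      TangleIsotopic [true] _
        [cup 1 false, cross 0 false, cross 0 false, cup 2 false, cross 1 s, cap 2, cap 1] :=
        .symm (.move 2 (.exchange (.cross false) (.cup false) 0 0))
      TangleIsotopic [true] _
        [cup 1 false, cross 0 false, cross 0 false, cup 1 false, cross 2 (!s), cap 2, cap 1] :=
        .symm (.move 3 (.slideCup 1 false (!s)) (by cases s <;> rfl) (by cases s <;> rfl))
      TangleIsotopic [true] _
        [cup 1 false, cross 0 false, cross 0 false, cup 1 false, cap 2, cap 1] :=
        .move 4 (.reidemeister1Cap 2 (!s))
      TangleIsotopic [true] _ [cup 1 false, cross 0 false, cross 0 false, cap 1] :=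
        .move 3 (.zigzagLeft 1 false)) hopf
  exact .resolved (.mk [cup 1 false, cup 2 false, cross 0 false, cross 0 false] [cap 2, cap 1]
    [true, false, false, true, true] 1 false false rfl rfl rfl rfl) (h true) (h false) (by ring)

theorem HasConway.closure_turnback : HasConway (closure [cap 0, cup 0 true, cross 1 true]) 1 :=
  TangleIsotopic.hasConway (calc
    TangleIsotopic [true] (closure [cap 0, cup 0 true, cross 1 true])
      [cup 1 false, cap 0, cup 0 false, cup 0 true, cross 1 true, cap 2, cap 1] :=
      .symm (.move 1 (.exchange .cap (.cup false) 0 0))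
    TangleIsotopic [true] _ [cup 0 false, cup 0 true, cross 1 true, cap 2, cap 1] :=
      .move 0 (.zigzagRight 0 false)
    TangleIsotopic [true] _ [cup 0 false, cup 1 true, cross 0 false, cap 2, cap 1] :=
      .move 1 (.slideCup 0 true true)
    TangleIsotopic [true] _ [cup 0 false, cup 1 true, cap 2, cross 0 false, cap 1] :=
      .move 2 (.exchange (.cross false) .cap 0 0)
    TangleIsotopic [true] _ [cup 0 false, cross 0 false, cap 1] := .move 1 (.zigzagLeft 1 true)
    TangleIsotopic [true] _ [cup 0 true, cap 1] := .move 0 (.reidemeister1Cup 0 false false)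
    TangleIsotopic [true] _ [] := .move 0 (.zigzagLeft 0 true)) .unknot

theorem HasConway.closure_turnback_split : HasConway (closure [cap 0, cup 0 true]) 0 :=
  TangleIsotopic.hasConway (calc
    TangleIsotopic [true] (closure [cap 0, cup 0 true])
      [cup 1 false, cap 0, cup 0 false, cup 0 true, cap 2, cap 1] :=
      .symm (.move 1 (.exchange .cap (.cup false) 0 0))
    TangleIsotopic [true] _ [cup 0 false, cup 0 true, cap 2, cap 1] :=
      .move 0 (.zigzagRight 0 false)
    TangleIsotopic [true] _ [cup 0 false, cap 0, cup 0 true, cap 1] :=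
      .move 1 (.exchange (.cup true) .cap 0 0)
    TangleIsotopic [true] _ [cup 0 false, cap 0] := .move 2 (.zigzagLeft 0 true)) split_left

/-- This diagram is a Hopf link. -/
theorem HasConway.closure_clasp :
    HasConway (closure [cross 0 false, cross 0 false, cross 1 false, cap 0, cup 0 false,
      cross 0 false, cross 1 true]) (-X) :=
  TangleIsotopic.hasConway (calc
    TangleIsotopic [true] (closure [cross 0 false, cross 0 false, cross 1 false, cap 0,
        cup 0 false, cross 0 false, cross 1 true])
      (closure [cross 0 false, cross 0 false, cross 1 false, cap 0, cup 0 true, cross 1 true]) :=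
      .move 6 (.reidemeister1Cup 0 false false)
    TangleIsotopic [true] _
      (closure [cross 0 false, cross 0 false, cross 0 true, cap 1, cup 0 true, cross 1 true]) :=
      .symm (.move 4 (.slideCap 0 true))
    TangleIsotopic [true] _ (closure [cross 0 false, cap 1, cup 0 true, cross 1 true]) :=
      .move 3 (.reidemeister2 0 false)
    TangleIsotopic [true] _ (closure [cross 1 true, cap 0, cup 0 true, cross 1 true]) :=
      .move 2 (.slideCap 0 false)
    TangleIsotopic [true] _ [cup 1 false, cup 1 false, cross 2 false, cap 0, cup 0 true,
        cross 1 true, cap 2, cap 1] := .symm (.move 1 (.slideCup 1 false false))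
    TangleIsotopic [true] _ [cup 1 false, cup 1 false, cap 0, cross 0 false, cup 0 true,
        cross 1 true, cap 2, cap 1] := .symm (.move 2 (.exchange .cap (.cross false) 0 0))
    TangleIsotopic [true] _ [cup 1 false, cross 0 false, cup 0 true, cross 1 true, cap 2, cap 1] :=
      .move 1 (.zigzagRight 0 false)
    TangleIsotopic [true] _ [cup 1 false, cross 0 false, cup 0 true, cross 2 false, cap 1, cap 1] :=
      .move 3 (.slideCap 1 true)
    TangleIsotopic [true] _ [cup 1 false, cross 0 false, cross 0 false, cup 0 true, cap 1, cap 1] :=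
      .move 2 (.exchange (.cup true) (.cross false) 0 0)
    TangleIsotopic [true] _ [cup 1 false, cross 0 false, cross 0 false, cap 1] :=
      .move 3 (.zigzagLeft 0 true)) hopf

/-- The closed full twist.  Changing its last crossing turns the second and the third strand into
two unlinked meridians of the first, a connected sum of two Hopf links. -/
theorem HasConway.closure_fullTwist : HasConway (closure leftFullTwistThree) (-X ^ 2) := by
  have hM : HasConway (closure [cross 0 false, cross 0 false, cross 1 false, cross 0 true,
      cross 0 false, cross 1 true]) 0 :=
    TangleIsotopic.hasConway (calc
      TangleIsotopic [true] (closure [cross 0 false, cross 0 false, cross 1 false, cross 0 true,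
          cross 0 false, cross 1 true])
        (closure [cross 0 false, cross 0 false, cross 1 false, cross 1 true]) :=
        .move 5 (.reidemeister2 0 true)
      TangleIsotopic [true] _ (closure [cross 0 false, cross 0 false]) :=
        .move 4 (.reidemeister2 1 false)) closure_split
  have hP : HasConway (closure [cross 0 false, cross 0 false, cross 1 false, cross 0 false,
      cross 0 false, cross 1 true]) (X ^ 2) :=
    .positive (.mk [cup 1 false, cup 2 false, cross 0 false, cross 0 false, cross 1 false]
      [cross 0 false, cross 1 true, cap 2, cap 1] [true, false, false, true, true] 0 true false
      rfl rfl rfl rfl) hM closure_clasp (by ring)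
  refine TangleIsotopic.hasConway leftFullTwistThree_isotopic.closure ?_
  exact .negative (.mk [cup 1 false, cup 2 false, cross 0 false, cross 0 false, cross 1 false,
    cross 0 false, cross 0 false] [cap 2, cap 1] [true, false, false, true, true] 1 false false
    rfl rfl rfl rfl) hP closure_torusLink (by ring)

/-- What remains of `L n` when one crossing of the twists is resolved and the kinks are removed. -/
theorem HasConway.closure_resolved_twists :
    HasConway (closure ([cup 2 true, cross 1 false, cross 0 true, cap 1] ++ leftFullTwistThree))
      (X ^ 3) := by
  have hM : HasConway (closure ([cup 2 true, cross 1 false, cross 0 false, cap 1] ++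
      leftFullTwistThree)) 0 :=
    TangleIsotopic.hasConway (calc
      TangleIsotopic [true] (closure ([cup 2 true, cross 1 false, cross 0 false, cap 1] ++
          leftFullTwistThree)) (closure ([cap 0, cup 0 true] ++ leftFullTwistThree)) :=
        (passOver_isotopic.context [] leftFullTwistThree rfl rfl rfl).closure
      TangleIsotopic [true] _ (closure [cap 0, cup 0 true, cross 0 false, cross 0 false,
          cross 1 false, cross 0 false, cross 0 false, cross 1 false]) :=
        (leftFullTwistThree_isotopic.context [cap 0, cup 0 true] [] rfl rfl rfl).closure
      TangleIsotopic [true] _ (closure [cap 0, cup 0 true, cross 1 true, cross 1 false]) :=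
        (turnback_isotopic.context [] [cross 1 false] rfl rfl rfl).closure
      TangleIsotopic [true] _ (closure [cap 0, cup 0 true]) := .move 4 (.reidemeister2 1 true))
      closure_turnback_split
  have hO : HasConway (closure ([cup 2 true, cross 1 false, cap 1] ++ leftFullTwistThree))
      (-X ^ 2) :=
    TangleIsotopic.hasConway (calc
      TangleIsotopic [true] (closure ([cup 2 true, cross 1 false, cap 1] ++ leftFullTwistThree))
        (closure ([cup 2 true, cap 1] ++ leftFullTwistThree)) :=
        .move 3 (.reidemeister1Cap 1 false)
      TangleIsotopic [true] _ (closure leftFullTwistThree) := .move 2 (.zigzagRight 1 true))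
      closure_fullTwist
  exact .positive (.mk [cup 1 false, cup 2 false, cup 2 true, cross 1 false]
    (cap 1 :: leftFullTwistThree ++ [cap 2, cap 1]) [true, true, false, false, false, true, true]
    0 true true rfl rfl rfl rfl) hM hO (by ring)

/-- The crossing that is changed is `cross 0 true`: the new strand then runs over the two others and
the diagram becomes an unknot; the resolution is a torus link `T(2, 4)`. -/
theorem hasConway_L_zero : HasConway (L 0) (1 + 2 * X ^ 2) := by
  have hM : HasConway (closure ([cup 2 true, cross 3 true, cross 1 false, cross 0 false, cap 1] ++
      leftFullTwistThree)) 1 :=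
    TangleIsotopic.hasConway (calc
      TangleIsotopic [true]
        (closure ([cup 2 true, cross 3 true, cross 1 false, cross 0 false, cap 1] ++
          leftFullTwistThree))
        (closure ([cup 2 true, cross 1 false, cross 3 true, cross 0 false, cap 1] ++
          leftFullTwistThree)) :=
        .symm (.move 3 (.exchange (.cross false) (.cross true) 1 0))
      TangleIsotopic [true] _
        (closure ([cup 2 true, cross 1 false, cross 0 false, cross 3 true, cap 1] ++
          leftFullTwistThree)) :=
        .symm (.move 4 (.exchange (.cross false) (.cross true) 0 1))
      TangleIsotopic [true] _
        (closure ([cup 2 true, cross 1 false, cross 0 false, cap 1, cross 1 true] ++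
          leftFullTwistThree)) :=
        .symm (.move 5 (.exchange .cap (.cross true) 1 0))
      TangleIsotopic [true] _ (closure ([cap 0, cup 0 true, cross 1 true] ++ leftFullTwistThree)) :=
        (passOver_isotopic.context [] (cross 1 true :: leftFullTwistThree) rfl rfl rfl).closure
      TangleIsotopic [true] _ (closure [cap 0, cup 0 true, cross 0 false, cross 0 false,
          cross 1 false, cross 0 false, cross 0 false]) :=
        (cross_leftFullTwistThree_isotopic.context [cap 0, cup 0 true] [] rfl rfl rfl).closure
      TangleIsotopic [true] _ (closure [cap 0, cup 0 true, cross 1 true]) :=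
        turnback_isotopic.closure)
      .closure_turnback
  have hO : HasConway (closure ([cup 2 true, cross 3 true, cross 1 false, cap 1] ++
      leftFullTwistThree)) (-2 * X) :=
    TangleIsotopic.hasConway (calc
      TangleIsotopic [true] (closure ([cup 2 true, cross 3 true, cross 1 false, cap 1] ++
          leftFullTwistThree))
        (closure ([cup 2 true, cross 3 true, cap 1] ++ leftFullTwistThree)) :=
        .move 4 (.reidemeister1Cap 1 false)
      TangleIsotopic [true] _ (closure ([cup 2 true, cap 1, cross 1 true] ++ leftFullTwistThree)) :=
        .symm (.move 3 (.exchange .cap (.cross true) 1 0))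
      TangleIsotopic [true] _ (closure ([cross 1 true] ++ leftFullTwistThree)) :=
        .move 2 (.zigzagRight 1 true)
      TangleIsotopic [true] _
        (closure [cross 0 false, cross 0 false, cross 1 false, cross 0 false, cross 0 false]) :=
        cross_leftFullTwistThree_isotopic.closure)
      .closure_torusLink
  exact .positive (.mk [cup 1 false, cup 2 false, cup 2 true, cross 3 true, cross 1 false]
    (cap 1 :: leftFullTwistThree ++ [cap 2, cap 1]) [true, true, false, false, false, true, true]
    0 true true rfl rfl rfl rfl) hM hO (by ring)

/-! ### The twists of `L n` -/

theorem run_leftTwists (n : ℕ) :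
    run [true, false, true, false, false, true, true] (leftTwists 2 n) =
      some [true, false, true, false, false, true, true] := by
  induction n with
  | zero => rfl
  | succ n ih => exact ih

/-- The twists above a local minimum are kinks. -/
theorem cup_leftTwists_isotopic (n : ℕ) :
    TangleIsotopic threeStrands (cup 2 true :: leftTwists 2 n) [cup 2 true] := by
  induction n with
  | zero => exact .refl _
  | succ n ih =>
    have h : TangleIsotopic threeStrands [cup 2 true, cross 2 false, cross 2 false] [cup 2 true] :=
      .trans (.move (E := [cup 2 false, cross 2 false]) 0 (.reidemeister1Cup 2 true false))
        (.move 0 (.reidemeister1Cup 2 false false))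
    exact .trans (h.context [] (leftTwists 2 n) rfl rfl
      (Option.isSome_of_mem (run_leftTwists n))) ih

/-- The part of `L n` above the twists. -/
def upperPart : Word :=
  [cross 1 false, cross 0 true, cap 1] ++ leftFullTwistThree ++ [cap 2, cap 1]

theorem L_eq (n : ℕ) :
    L n = [cup 1 false, cup 2 false, cup 2 true, cross 3 true] ++
      (leftTwists 2 n ++ upperPart) := by
  simp [L, moduleTangle, upperPart]

/-- The resolution of the first crossing of the twists of `L (n + 1)` does not depend on `n` up to
isotopy. -/
theorem HasConway.resolved_twist (n : ℕ) :
    HasConway ([cup 1 false, cup 2 false, cup 2 true, cross 3 true, cap 2, cup 2 false,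
      cross 2 false] ++ (leftTwists 2 n ++ upperPart)) (X ^ 3) := by
  have hrun : run [true, false, true, false, false, true, true] (leftTwists 2 n ++ upperPart) =
      some [true] := by
    rw [run_append, run_leftTwists]; rfl
  have hkink : TangleIsotopic threeStrands [cup 2 true, cross 3 true, cap 2] [] := calc
    TangleIsotopic threeStrands [cup 2 true, cross 3 true, cap 2]
      [cup 3 true, cross 2 false, cap 2] := .move 0 (.slideCup 2 true true)
    TangleIsotopic threeStrands _ [cup 3 true, cap 2] := .move 1 (.reidemeister1Cap 2 false)
    TangleIsotopic threeStrands _ [] := .move 0 (.zigzagRight 2 true)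
  have hflip : TangleIsotopic threeStrands [cup 2 false, cross 2 false] [cup 2 true] :=
    .move 0 (.reidemeister1Cup 2 false false)
  have h := (hkink.context (w := [true]) (r := threeStrands) [cup 1 false, cup 2 false]
    ([cup 2 false, cross 2 false] ++ (leftTwists 2 n ++ upperPart))
    rfl rfl (Option.isSome_of_mem hrun)).trans <|
    (hflip.context [cup 1 false, cup 2 false] (leftTwists 2 n ++ upperPart)
    rfl rfl (Option.isSome_of_mem hrun)).trans <|
    (cup_leftTwists_isotopic n).context [cup 1 false, cup 2 false] upperPart rfl
      (run_leftTwists n) rfl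
  exact h.hasConway closure_resolved_twists hrun

theorem hasConway_L (n : ℕ) : HasConway (L n) (1 + 2 * X ^ 2 - (n : ℤ[X]) * X ^ 4) := by
  induction n with
  | zero => simpa using hasConway_L_zero
  | succ n ih =>
    rw [L_eq] at ih ⊢
    have hrun : run [true, false, true, false, false, true, true] (leftTwists 2 n ++ upperPart) =
        some [true] := by
      rw [run_append, run_leftTwists]; rfl
    have hR2 : TangleIsotopic [true, false, true, false, false, true, true]
      [cross 2 true, cross 2 false] [] := .move 0 (.reidemeister2 2 true)
    have hM := (hR2.context (w := [true]) [cup 1 false, cup 2 false, cup 2 true, cross 3 true] _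
      rfl rfl (Option.isSome_of_mem hrun)).hasConway ih hrun
    -- The lowest crossing of the twists is positive as its two strands are antiparallel.
    exact .positive (.mk [cup 1 false, cup 2 false, cup 2 true, cross 3 true] (cross 2 false ::
      (leftTwists 2 n ++ upperPart))
      [true, false, true, false, false, true, true] 2 true false rfl rfl rfl hrun)
      hM (.resolved_twist n) (by push_cast; ring)

end KnotSkein

theorem lemma6p1 (n : ℕ) :
    KnotSkein.conway (KnotSkein.L n) = 1 + 2 * X ^ 2 - (n : ℤ[X]) * X ^ 4 ∧
      (KnotSkein.conway (KnotSkein.L n)).coeff 4 = -(n : ℤ) := by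
  rw [(KnotSkein.hasConway_L n).conway_eq]
  refine ⟨rfl, ?_⟩
  have h2 : (2 : ℤ[X]) = C 2 := rfl
  rw [← C_eq_natCast, h2]
  simp [coeff_X_pow, coeff_one]
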